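/- **Setting.** Consider an episodic Markov decision process with state space $\mathcal S$, action space $\mathcal A$, $H\ge 1$ steps, fixed initial state $s_1$, transition kernels $\mathbb P_h(\cdot\mid s,a)$ and deterministic rewards $r_h(s,a)\ge 0$ ($h\in[H]$) with $\sum_{h=1}^H r_h(s_h,a_h)\le 1$ along every possible trajectory. For a deterministic policy $\pi=(\pi_h)_{h\in[H]}$, $\pi_h:\mathcal S\to\mathcal A$, let $V^\pi_h$, $Q^\pi_h$ be its value functions, and let $V^\star_h=\sup_\pi V_h^\pi$, $Q^\star_h=\sup_\pi Q_h^\pi$. Write $(\mathcal T_h f)(s,a)=r_h(s,a)+\mathbb E_{s'\sim\mathbb P_h(\cdot\mid s,a)}\max_{a'}f(s',a')$. Let $\mathcal F=\mathcal F_1\times\dots\times\mathcal F_H$ and $\mathcal G=\mathcal G_1\times\dots\times\mathcal G_H$ with $\mathcal F_h,\mathcal G_h\subseteq(\mathcal S\times\mathcal A\to[0,1])$; put $f_{H+1}=0$ for $f\in\mathcal F$ and $\mathcal F_{H+1}=\{0\}$. Each $f\in\mathcal F$ has a greedy policy $\pi_f$, $\pi_{f,h}(s)\in\operatorname{argmax}_a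 f_h(s,a)$. (All functions, policies and the choices made by the algorithm are assumed measurable.) **Algorithm.** GOLF with parameters $(\mathcal F,\mathcal G,K,\beta)$ starts with empty data sets $\mathcal D_1,\dots,\mathcal D_H$ and $\mathcal B^0=\mathcal F$. In episode $k=1,\dots,K$ it chooses $f^k\in\operatorname{argmax}_{f\in\mathcal B^{k-1}}f_1(s_1,\pi_{f,1}(s_1))$, executes $\pi^k=\pi_{f^k}$ for one episode, adds the observed $(s_h,a_h,r_h,s_{h+1})$ to $\mathcal D_h$ for every $h$, and sets $$\mathcal B^k=\Big\{f\in\mathcal F:\ \mathcal L_{\mathcal D_h}(f_h,f_{h+1})\le\inf_{g\in\mathcal G_h}\mathcal L_{\mathcal D_h}(g,f_{h+1})+\beta\ \ \forall h\in[H]\Big\},\qquad \mathcal L_{\mathcal D_h}(\xi,\zeta)=\sum_{(s,a,r,s')\in\mathcal D_h}\big[\xi(s,a)-r-\max_{a'}\zeta(s',a')\big]^2 .$$ (The argmax is assumed to be attained whenever $\mathcal B^{k-1}\ne\emptyset$; if $\mathcal B^{k-1}=\emptyset$, then $f^k\in\mathcal F$ is arbitrary.) **Complexity measures.** $\mathcal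 N_{\mathcal F\cup\mathcal G}(\epsilon)$ is the least cardinality of a subset of $\mathcal F\cup\mathcal G$ that is an $\epsilon$-cover of $\mathcal F\cup\mathcal G$ for the metric $\max_h\|f_h-g_h\|_\infty$. For a class $\Phi$ of functions on $\mathcal X$, a probability measure $\nu$ is $\epsilon$-independent of $\mu_1,\dots,\mu_n$ if some $g\in\Phi$ satisfies $\sqrt{\sum_i(\mathbb E_{\mu_i}g)^2}\le\epsilon<|\mathbb E_\nu g|$; $\dim_{\mathrm{DE}}(\Phi,\Pi,\epsilon)$ is the largest length of a sequence in $\Pi$ such that, for some $\epsilon'\ge\epsilon$, each member is $\epsilon'$-independent of its predecessors; and $\dim_{\mathrm{BE}}(\mathcal F,\Pi,\epsilon)=\max_{h\in[H]}\dim_{\mathrm{DE}}(\{f_h-\mathcal T_hf_{h+1}:f\in\mathcal F\},\Pi_h,\epsilon)$. Let $\mathcal D_{\Delta,h}$ be the set of all point masses on $\mathcal S\times\mathcal A$, and $\mathcal D_{\mathcal F,h}$ the set of the laws of $(s_h,a_h)$ under the policies $\pi_f$, $f\in\mathcal F$. **Theorem (Regret of GOLF).** There are absolute constants $c,C>0$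 such that the following holds. Assume realizability, $Q^\star_h\in\mathcal F_h$ for all $h\in[H]$, and generalized completeness, $\mathcal T_h\mathcal F_{h+1}\subseteq\mathcal G_h$ for all $h\in[H]$. Let $\delta\in(0,1]$ and let $K\ge 2$ be an integer, assume that $\mathcal N_{\mathcal F\cup\mathcal G}(1/K)$ and $$d=\min_{\Pi\in\{\mathcal D_\Delta,\mathcal D_{\mathcal F}\}}\dim_{\mathrm{BE}}\big(\mathcal F,\Pi,1/\sqrt K\big)$$ are finite, and run GOLF with $\beta=c\log[\mathcal N_{\mathcal F\cup\mathcal G}(1/K)\cdot KH/\delta]$. Then, with probability at least $1-\delta$, for all $k\in[K]$, $$\mathrm{Reg}(k)=\sum_{t=1}^k\big[V_1^\star(s_1)-V_1^{\pi^t}(s_1)\big]\le C\,H\sqrt{\max\{d,1\}\,k\,\beta}.$$ -/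

import Mathlib

open MeasureTheory ProbabilityTheory
open scoped NNReal ENNReal

noncomputable section

namespace Golf

/-- The record of one episode with `n` steps: at step `h` it holds `((s_h, a_h), s_{h+1})`.
Steps are numbered from `0`, and rewards are deterministic functions of `(s_h, a_h)`. -/
abbrev Traj (S A : Type*) (n : ℕ) : Type _ := Fin n → (S × A) × S

/-- A tuple `(f_1, …, f_H)` of functions on state-action pairs. -/
abbrev QTuple (S A : Type*) (H : ℕ) : Type _ := Fin H → S × A → ℝ

/-- A deterministic policy with `n` steps. -/
abbrev Policy (S A : Type*) (n : ℕ) : Type _ := Fin n → S → A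

section Basic

variable {S A : Type*} [MeasurableSpace S] [MeasurableSpace A]

/-- The law of the trajectory that starts at `s`, takes the action `π_h(s_h)` at each step `h`
and moves to `s_{h+1} ∼ P_h(· ∣ s_h, a_h)`. -/
def trajLaw : (n : ℕ) → (Fin n → Kernel (S × A) S) → Policy S A n → S → Measure (Traj S A n)
  | 0, _, _, _ => Measure.dirac Fin.elim0
  | n + 1, P, π, s =>
      (P 0 (s, π 0 s)).bind fun s' =>
        (trajLaw n (fun i => P i.succ) (fun i => π i.succ) s').map
          (Fin.cons (α := fun _ => (S × A) × S) ((s, π 0 s), s'))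

variable (S A) in
/-- An episodic Markov decision process with `H` steps and a fixed initial state. Rewards are
nonnegative, and the total reward of an episode is at most `1` (almost surely, under every
policy). -/
structure MDP (H : ℕ) where
  /-- transition probabilities -/
  P : Fin H → Kernel (S × A) S
  markov : ∀ h, IsMarkovKernel (P h)
  /-- rewards -/
  r : Fin H → S × A → ℝ
  measurable_r : ∀ h, Measurable (r h)
  r_nonneg : ∀ h x, 0 ≤ r h x
  /-- initial state -/
  s₁ : S
  sum_r_le_one : ∀ π : Policy S A H, (∀ h, Measurable (π h)) →
    ∀ᵐ τ ∂(trajLaw H P π s₁), ∑ h, r h (τ h).1 ≤ 1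

/-- The entry of a tuple at step `j`, with the convention that it is `0` after the last step. -/
def entry {H : ℕ} (f : QTuple S A H) (j : ℕ) : S × A → ℝ :=
  if hj : j < H then f ⟨j, hj⟩ else 0

/-- The function class at step `j`, which is `{0}` after the last step. -/
def classAt {H : ℕ} (F : Fin H → Set (S × A → ℝ)) (j : ℕ) : Set (S × A → ℝ) :=
  if hj : j < H then F ⟨j, hj⟩ else {0}

/-- The product class `F_1 × ⋯ × F_H`. -/
def prodClass {H : ℕ} (F : Fin H → Set (S × A → ℝ)) : Set (QTuple S A H) := Set.univ.pi F

/-- The `ε`-covering number (with centres in the class) of a class of tuples for the metric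
`ρ(f, g) = max_h ‖f_h - g_h‖_∞`. -/
def coverNum {H : ℕ} (V : Set (QTuple S A H)) (ε : ℝ≥0) : ℕ∞ :=
  Metric.coveringNumber ε
    ((fun (f : QTuple S A H) (h : Fin H) => UniformFun.ofFun (f h)) '' V)

/-- `ν` is `ε`-independent of `μ_1, …, μ_n` with respect to the function class `Φ`. -/
def IsIndepOf {X : Type*} [MeasurableSpace X] (Φ : Set (X → ℝ)) (ε : ℝ) (ν : Measure X) {n : ℕ}
    (μ : Fin n → Measure X) : Prop :=
  ∃ g ∈ Φ, Real.sqrt (∑ i, (∫ x, g x ∂(μ i)) ^ 2) ≤ ε ∧ ε < |∫ x, g x ∂ν|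

/-- The distributional Eluder dimension: the supremum of the lengths `n` of sequences in `Ps`
such that, for some `ε' ≥ ε`, each member is `ε'`-independent of its predecessors. -/
def deDim {X : Type*} [MeasurableSpace X] (Φ : Set (X → ℝ)) (Ps : Set (Measure X)) (ε : ℝ) : ℕ∞ :=
  ⨆ (n : ℕ) (_ : ∃ ρ : Fin n → Measure X, (∀ i, ρ i ∈ Ps) ∧
    ∃ ε' : ℝ, ε ≤ ε' ∧ ∀ i : Fin n,
      IsIndepOf Φ ε' (ρ i) (fun j : Fin i => ρ (Fin.castLE i.isLt.le j))), (n : ℕ∞)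

namespace MDP

variable {H : ℕ} (M : MDP S A H)

/-- `V^π_h(s)`, the expected total reward from step `h` on, starting from `s_h = s`. -/
def V (π : Policy S A H) (h : ℕ) (s : S) : ℝ :=
  ∫ τ, ∑ i : Fin (H - h), M.r ⟨h + i, by omega⟩ (τ i).1
    ∂(trajLaw (H - h) (fun i => M.P ⟨h + i, by omega⟩) (fun i => π ⟨h + i, by omega⟩) s)

/-- `Q^π_h(s, a)`, the expected total reward from step `h` on, starting from `s_h = s`, `a_h = a`
and following `π` afterwards. -/
def Q (π : Policy S A H) (h : Fin H) (x : S × A) : ℝ :=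
  M.r h x + ∫ s', M.V π (h + 1) s' ∂(M.P h x)

/-- The optimal value function, a supremum over (measurable) policies. -/
def Vstar (h : ℕ) (s : S) : ℝ :=
  ⨆ π : {π : Policy S A H // ∀ h, Measurable (π h)}, M.V π.1 h s

/-- The optimal `Q`-function, a supremum over (measurable) policies. -/
def Qstar (h : Fin H) (x : S × A) : ℝ :=
  ⨆ π : {π : Policy S A H // ∀ h, Measurable (π h)}, M.Q π.1 h x

/-- The Bellman operator
`(T_h f)(s, a) = r_h(s, a) + E_{s' ∼ P_h(· ∣ s, a)} max_{a'} f(s', a')`. -/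
def bellman (h : Fin H) (f : S × A → ℝ) (x : S × A) : ℝ :=
  M.r h x + ∫ s', ⨆ a', f (s', a') ∂(M.P h x)

/-- The Bellman residuals `f_h - T_h f_{h+1}` of the tuples `f ∈ F`. -/
def residuals (F : Fin H → Set (S × A → ℝ)) (h : Fin H) : Set (S × A → ℝ) :=
  {g | ∃ f ∈ prodClass F, g = fun x => f h x - M.bellman h (entry f (h + 1)) x}

/-- The (Q-type) Bellman Eluder dimension. -/
def beDim (F : Fin H → Set (S × A → ℝ)) (Ps : Fin H → Set (Measure (S × A))) (ε : ℝ) : ℕ∞ :=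
  ⨆ h : Fin H, deDim (M.residuals F h) (Ps h) ε

/-- The family of the laws of `(s_h, a_h)` under the greedy policies `π_f` of the tuples
`f ∈ F`. -/
def greedyFamily (F : Fin H → Set (S × A → ℝ)) (greedy : QTuple S A H → Policy S A H)
    (h : Fin H) : Set (Measure (S × A)) :=
  {μ | ∃ f ∈ prodClass F, μ = (trajLaw H M.P (greedy f) M.s₁).map fun τ => (τ h).1}

/-- Realizability. -/
def Realizable (F : Fin H → Set (S × A → ℝ)) : Prop := ∀ h, M.Qstar h ∈ F h

/-- Generalized completeness. -/
def Complete (F G : Fin H → Set (S × A → ℝ)) : Prop :=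
  ∀ h : Fin H, M.bellman h '' classAt F (h + 1) ⊆ G h

/-- The squared loss of the pair `(ξ, ζ)` at step `h` on the data of `k` episodes. -/
def loss {k : ℕ} (D : Fin k → Traj S A H) (h : Fin H) (ξ ζ : S × A → ℝ) : ℝ :=
  ∑ t, (ξ (D t h).1 - M.r h (D t h).1 - ⨆ a', ζ ((D t h).2, a')) ^ 2

/-- The confidence set built from the data of `k` episodes. Without data the loss vanishes, so
that for `k = 0` (and `0 ≤ β`) this is all of `F`. -/
def confSet (F G : Fin H → Set (S × A → ℝ)) (β : ℝ) {k : ℕ} (D : Fin k → Traj S A H) :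
    Set (QTuple S A H) :=
  {f | f ∈ prodClass F ∧ ∀ h : Fin H,
    M.loss D h (f h) (entry f (h + 1)) ≤ (⨅ g : G h, M.loss D h g.1 (entry f (h + 1))) + β}

/-- The joint law of the first `k` episodes when, after the episodes recorded in
`D = (D_0, …, D_{t-1})`, the next episode follows the policy `pol t D`. -/
def runLaw (pol : (t : ℕ) → (Fin t → Traj S A H) → Policy S A H) :
    (k : ℕ) → Measure (Fin k → Traj S A H)
  | 0 => Measure.dirac Fin.elim0
  | k + 1 => (runLaw pol k).bind fun D =>
      (trajLaw H M.P (pol k D) M.s₁).map (Fin.snoc (α := fun _ => Traj S A H) D)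

/-- The regret of the first `k` of `K` episodes with record `D`. -/
def regret (pol : (t : ℕ) → (Fin t → Traj S A H) → Policy S A H) {K : ℕ}
    (D : Fin K → Traj S A H) (k : ℕ) (hk : k ≤ K) : ℝ :=
  ∑ t : Fin k, (M.Vstar 0 M.s₁ -
    M.V (pol t fun i : Fin t => D (Fin.castLE (t.isLt.le.trans hk) i)) 0 M.s₁)

end MDP

/-- `greedy` assigns to every tuple `f ∈ F` a greedy policy `π_f`, that is, a (measurable) policy
with `π_{f,h}(s) ∈ argmax_a f_h(s, a)`. -/
structure IsGreedy {H : ℕ} (F : Fin H → Set (S × A → ℝ))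
    (greedy : QTuple S A H → Policy S A H) : Prop where
  measurable : ∀ f ∈ prodClass F, ∀ h, Measurable (greedy f h)
  isMax : ∀ f ∈ prodClass F, ∀ h s a, f h (s, a) ≤ f h (s, greedy f h s)

/-- `sel` is the optimistic planning step of GOLF with parameters `F, G, K, β`: from the data `D`
of the `k` previous episodes it computes a maximizer of `f ↦ f_1(s_1, π_f(s_1))` over the
confidence set. If the confidence set is empty, the algorithm is not specified, and any member of
`F` may be chosen. The choice and its greedy policy depend measurably on the data. -/
structure IsGolf {H : ℕ} [NeZero H] (M : MDP S A H) (F G : Fin H → Set (S × A → ℝ)) (K : ℕ)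
    (β : ℝ) (greedy : QTuple S A H → Policy S A H)
    (sel : (k : ℕ) → (Fin k → Traj S A H) → QTuple S A H) : Prop where
  mem : ∀ k < K, ∀ D, sel k D ∈ prodClass F
  mem_confSet : ∀ k < K, ∀ D, (M.confSet F G β D).Nonempty → sel k D ∈ M.confSet F G β D
  isMax : ∀ k < K, ∀ D, ∀ f ∈ M.confSet F G β D,
    f 0 (M.s₁, greedy f 0 M.s₁) ≤ sel k D 0 (M.s₁, greedy (sel k D) 0 M.s₁)
  measurable_sel : ∀ k < K, ∀ h,
    Measurable fun p : (Fin k → Traj S A H) × (S × A) => sel k p.1 h p.2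
  measurable_policy : ∀ k < K, ∀ h,
    Measurable fun p : (Fin k → Traj S A H) × S => greedy (sel k p.1) h p.2

/-- The family of point masses on state-action pairs (the same at every step). -/
def diracFamily (S A : Type*) [MeasurableSpace S] [MeasurableSpace A] : Set (Measure (S × A)) :=
  Set.range Measure.dirac

end Basic

end Golf

end

/-! The proof combines optimism with a regression analysis. On an event of probability at least `1 -
δ`, `Q^⋆` lies in every confidence set, so the value that the selected tuple `f^t` claims at `s_1`
dominates `V^⋆_1(s_1)`. The regret of episode `t` is then at most the claimed value minus `V^{π^t}`.
This difference telescopes along `π^t` into the sum over `h` of the expected Bellman residuals of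
`f^t` under `π^t` itself (`sub_V_eq_sum_integral_resid`).

Membership in the confidence set controls `f^t` only on the past: the squared residuals, summed over
past data or in expectation over past policies, are `O(β)` (`sum_sq_resid_le`,
`sum_integral_sq_resid_le`). The distributional Eluder dimension transfers this to the present.
Times at which the present residual exceeds `ε` can be distributed into about `B / ε²` buckets, each
of which is an `ε`-independent sequence and so has length at most `d` (`card_large_le`). Integrating
this count over `ε` bounds the sum of the residuals by a multiple of `√(d β k)` when `d ≥ 1`
(`sum_abs_integral_le`).

The statistical input is one exponential inequality. The excess squared loss over the regression
target is `X = Δ² + 2Δξ`, where `ξ` is centred given `(s_h, a_h)` and ranges over an interval of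
length one. Hoeffding's lemma gives `E[exp(Δ²/2 - X) | s_h, a_h] ≤ 1`, and averaging over `(s_h,
a_h)` gives `E exp(EΔ²/4 - X) ≤ 1`. Products over episodes are supermartingales, so Markov's
inequality and a union bound over nets, steps and prefix lengths suffice. Nets are needed because
`f^t` depends on the data that its loss is measured on; at scale `1/K` the discretization costs
`O(1)` over `K` episodes. -/

open MeasureTheory ProbabilityTheory
open scoped NNReal ENNReal

noncomputable section

namespace Golf

/-! ### Measurable families of probability measures -/

section Measures

variable {α β γ : Type*} [MeasurableSpace α] [MeasurableSpace β] [MeasurableSpace γ]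

/-- A measurable family of probability measures, as a kernel. -/
def familyKernel (κ : α → Measure β) (hκ : Measurable κ) : Kernel α β := ⟨κ, hκ⟩

lemma isMarkovKernel_familyKernel (κ : α → Measure β) (hκ : Measurable κ)
    (h : ∀ a, IsProbabilityMeasure (κ a)) : IsMarkovKernel (familyKernel κ hκ) := ⟨h⟩

/-- The map may vary with the parameter too: the mass of a set is then the kernel measure of a
section of a measurable subset of the product. -/
lemma measurable_map_family {κ : α → Measure β} (hκ : Measurable κ)
    (h : ∀ a, IsProbabilityMeasure (κ a)) {F : α → β → γ}
    (hF : Measurable fun p : α × β => F p.1 p.2) :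
    Measurable fun a => (κ a).map (F a) := by
  refine Measure.measurable_of_measurable_coe _ fun s hs => ?_
  have := isMarkovKernel_familyKernel κ hκ h
  have hm : ∀ a, Measurable (F a) := fun a => hF.comp measurable_prodMk_left
  simp_rw [Measure.map_apply (hm _) hs]
  exact Kernel.measurable_kernel_prodMk_left (κ := familyKernel κ hκ) (hF hs)

lemma measurable_lintegral_family {κ : α → Measure β} (hκ : Measurable κ)
    (h : ∀ a, IsProbabilityMeasure (κ a)) {F : α → β → ℝ≥0∞}
    (hF : Measurable fun p : α × β => F p.1 p.2) :
    Measurable fun a => ∫⁻ b, F a b ∂(κ a) := by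
  have := isMarkovKernel_familyKernel κ hκ h
  exact Measurable.lintegral_kernel_prod_right (κ := familyKernel κ hκ) hF

lemma measurable_integral_family {κ : α → Measure β} (hκ : Measurable κ)
    (h : ∀ a, IsProbabilityMeasure (κ a)) {F : α → β → ℝ}
    (hF : Measurable fun p : α × β => F p.1 p.2) :
    Measurable fun a => ∫ b, F a b ∂(κ a) := by
  have := isMarkovKernel_familyKernel κ hκ h
  exact (StronglyMeasurable.integral_kernel_prod_right (κ := familyKernel κ hκ)
    hF.stronglyMeasurable).measurable

lemma measurable_bind_family {κ : α → Measure β} (hκ : Measurable κ)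
    (h : ∀ a, IsProbabilityMeasure (κ a)) {η : α → β → Measure γ}
    (hη : Measurable fun p : α × β => η p.1 p.2) :
    Measurable fun a => (κ a).bind (η a) := by
  refine Measure.measurable_of_measurable_coe _ fun s hs => ?_
  have hm : ∀ a, Measurable (η a) := fun a => hη.comp measurable_prodMk_left
  simp_rw [Measure.bind_apply hs (hm _).aemeasurable]
  exact measurable_lintegral_family hκ h ((Measure.measurable_coe hs).comp hη)

lemma isProbabilityMeasure_bind {μ : Measure α} [IsProbabilityMeasure μ] {η : α → Measure β}
    (hη : Measurable η) (h : ∀ a, IsProbabilityMeasure (η a)) :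
    IsProbabilityMeasure (μ.bind η) := by
  constructor
  rw [Measure.bind_apply MeasurableSet.univ hη.aemeasurable]
  simp

lemma integrable_of_abs_le {μ : Measure α} [IsFiniteMeasure μ] {f : α → ℝ} (hf : Measurable f)
    {B : ℝ} (hB : ∀ a, |f a| ≤ B) : Integrable f μ :=
  Integrable.of_bound hf.aestronglyMeasurable B (Filter.Eventually.of_forall hB)

lemma abs_integral_le_of_abs_le {μ : Measure α} [IsProbabilityMeasure μ] {f : α → ℝ}
    {B : ℝ} (hB : ∀ a, |f a| ≤ B) : |∫ a, f a ∂μ| ≤ B := by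
  have := norm_integral_le_of_norm_le_const (μ := μ) (f := f) (Filter.Eventually.of_forall hB)
  simpa using this

lemma integral_bind_of_abs_le {μ : Measure α} [IsProbabilityMeasure μ] {η : α → Measure β}
    (hη : Measurable η) (h : ∀ a, IsProbabilityMeasure (η a)) {f : β → ℝ} (hf : Measurable f)
    {B : ℝ} (hB : ∀ b, |f b| ≤ B) :
    ∫ b, f b ∂(μ.bind η) = ∫ a, ∫ b, f b ∂(η a) ∂μ := by
  have := isMarkovKernel_familyKernel η hη h
  have := isProbabilityMeasure_bind (μ := μ) hη h
  have key := Kernel.integral_comp (κ := Kernel.const Unit μ) (η := familyKernel η hη) (a := ())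
    (f := f)
  rw [Kernel.comp_apply, Kernel.const_apply] at key
  exact key (integrable_of_abs_le (μ := μ.bind η) hf hB)

end Measures

/-! ### The law of one episode -/

section Trajectories

variable {S A Ω : Type*} [MeasurableSpace S] [MeasurableSpace A] [MeasurableSpace Ω]

lemma measurable_fin_cons {X : Type*} [MeasurableSpace X] {n : ℕ} :
    Measurable fun p : X × (Fin n → X) => (Fin.cons p.1 p.2 : Fin (n + 1) → X) := by
  refine measurable_pi_iff.2 fun i => ?_
  refine Fin.cases ?_ (fun j => ?_) i
  · simpa using measurable_fst
  · simp only [Fin.cons_succ]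
    exact (measurable_pi_apply j).comp measurable_snd

lemma measurable_fin_snoc {X : Type*} [MeasurableSpace X] {n : ℕ} :
    Measurable fun p : (Fin n → X) × X => (Fin.snoc p.1 p.2 : Fin (n + 1) → X) := by
  refine measurable_pi_iff.2 fun i => ?_
  refine Fin.lastCases ?_ (fun j => ?_) i
  · simpa using measurable_snd
  · simp only [Fin.snoc_castSucc]
    exact (measurable_pi_apply j).comp measurable_fst

/-- The two claims share an induction, because measurability of the one-step mixture uses that the
continuation laws are probability measures. The parameter `ω` lets the policy depend on past data,
as `runLaw` requires. -/
lemma measurable_trajLaw_and_isProbabilityMeasure (n : ℕ) (P : Fin n → Kernel (S × A) S)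
    [∀ i, IsMarkovKernel (P i)] (π : Ω → Policy S A n)
    (hπ : ∀ i, Measurable fun p : Ω × S => π p.1 i p.2) :
    (Measurable fun p : Ω × S => trajLaw n P (π p.1) p.2) ∧
      ∀ p : Ω × S, IsProbabilityMeasure (trajLaw n P (π p.1) p.2) := by
  induction n with
  | zero =>
    simp only [trajLaw]
    exact ⟨measurable_const, fun _ => inferInstance⟩
  | succ n ih =>
    obtain ⟨ihm, ihp⟩ := ih (fun i => P i.succ) (fun ω i => π ω i.succ) (fun i => hπ i.succ)
    have hstate : Measurable fun p : Ω × S => (p.2, π p.1 0 p.2) :=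
      measurable_snd.prodMk (hπ 0)
    have hinner : Measurable fun q : (Ω × S) × S =>
        (trajLaw n (fun i => P i.succ) (fun i => π q.1.1 i.succ) q.2).map
          (Fin.cons (α := fun _ => (S × A) × S) ((q.1.2, π q.1.1 0 q.1.2), q.2)) := by
      refine measurable_map_family (κ := fun q : (Ω × S) × S =>
        trajLaw n (fun i => P i.succ) (fun i => π q.1.1 i.succ) q.2)
        (F := fun q : (Ω × S) × S =>
          Fin.cons (α := fun _ => (S × A) × S) ((q.1.2, π q.1.1 0 q.1.2), q.2))
        (ihm.comp ((measurable_fst.comp measurable_fst).prodMk measurable_snd))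
        (fun q => ihp (q.1.1, q.2)) ?_
      refine measurable_fin_cons.comp (Measurable.prodMk (Measurable.prodMk ?_ ?_) measurable_snd)
      · exact hstate.comp (measurable_fst.comp measurable_fst)
      · exact measurable_snd.comp measurable_fst
    refine ⟨?_, fun p => ?_⟩
    · exact measurable_bind_family (κ := fun p : Ω × S => P 0 (p.2, π p.1 0 p.2))
        ((P 0).measurable.comp hstate) (fun p => inferInstance) hinner
    · refine isProbabilityMeasure_bind (hinner.comp measurable_prodMk_left) fun s' => ?_
      have := ihp (p.1, s')
      exact Measure.isProbabilityMeasure_map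
        (measurable_fin_cons.comp measurable_prodMk_left).aemeasurable

lemma measurable_trajLaw_param {n : ℕ} {P : Fin n → Kernel (S × A) S}
    [∀ i, IsMarkovKernel (P i)] {π : Ω → Policy S A n}
    (hπ : ∀ i, Measurable fun p : Ω × S => π p.1 i p.2) (s : S) :
    Measurable fun ω : Ω => trajLaw n P (π ω) s :=
  (measurable_trajLaw_and_isProbabilityMeasure n P π hπ).1.comp measurable_prodMk_right

lemma measurable_trajLaw {n : ℕ} {P : Fin n → Kernel (S × A) S}
    [∀ i, IsMarkovKernel (P i)] {π : Policy S A n} (hπ : ∀ i, Measurable (π i)) :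
    Measurable fun s => trajLaw n P π s :=
  (measurable_trajLaw_and_isProbabilityMeasure (Ω := Unit) n P (fun _ => π)
    (fun i => (hπ i).comp measurable_snd)).1.comp (measurable_prodMk_left (x := ()))

lemma isProbabilityMeasure_trajLaw {n : ℕ} {P : Fin n → Kernel (S × A) S}
    [∀ i, IsMarkovKernel (P i)] {π : Policy S A n} (hπ : ∀ i, Measurable (π i)) (s : S) :
    IsProbabilityMeasure (trajLaw n P π s) :=
  (measurable_trajLaw_and_isProbabilityMeasure (Ω := Unit) n P (fun _ => π)
    (fun i => (hπ i).comp measurable_snd)).2 ((), s)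

section Succ

variable {n : ℕ} {P : Fin (n + 1) → Kernel (S × A) S} [∀ i, IsMarkovKernel (P i)]
  {π : Policy S A (n + 1)}

lemma measurable_trajLaw_map_cons (hπ : ∀ i, Measurable (π i)) (x : S × A) :
    Measurable fun s' => (trajLaw n (fun i => P i.succ) (fun i => π i.succ) s').map
      (Fin.cons (α := fun _ => (S × A) × S) (x, s')) :=
  measurable_map_family (measurable_trajLaw fun i => hπ i.succ)
    (fun s' => isProbabilityMeasure_trajLaw (fun i => hπ i.succ) s')
    (F := fun s' => Fin.cons (α := fun _ => (S × A) × S) (x, s'))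
    (measurable_fin_cons.comp
      ((measurable_const.prodMk measurable_fst).prodMk measurable_snd))

lemma lintegral_trajLaw_succ (hπ : ∀ i, Measurable (π i)) (s : S)
    {g : Traj S A (n + 1) → ℝ≥0∞} (hg : Measurable g) :
    ∫⁻ τ, g τ ∂(trajLaw (n + 1) P π s) =
      ∫⁻ s', ∫⁻ τ, g (Fin.cons ((s, π 0 s), s') τ)
        ∂(trajLaw n (fun i => P i.succ) (fun i => π i.succ) s') ∂(P 0 (s, π 0 s)) := by
  rw [trajLaw, Measure.lintegral_bind (measurable_trajLaw_map_cons hπ _).aemeasurable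
    hg.aemeasurable]
  refine lintegral_congr fun s' => ?_
  exact lintegral_map hg (measurable_fin_cons.comp measurable_prodMk_left)

lemma integral_trajLaw_succ (hπ : ∀ i, Measurable (π i)) (s : S)
    {g : Traj S A (n + 1) → ℝ} (hg : Measurable g) {B : ℝ} (hB : ∀ τ, |g τ| ≤ B) :
    ∫ τ, g τ ∂(trajLaw (n + 1) P π s) =
      ∫ s', ∫ τ, g (Fin.cons ((s, π 0 s), s') τ)
        ∂(trajLaw n (fun i => P i.succ) (fun i => π i.succ) s') ∂(P 0 (s, π 0 s)) := by
  have hc : ∀ s', Measurable (Fin.cons (α := fun _ => (S × A) × S) ((s, π 0 s), s') :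
      Traj S A n → Traj S A (n + 1)) :=
    fun s' => measurable_fin_cons.comp measurable_prodMk_left
  rw [trajLaw, integral_bind_of_abs_le (measurable_trajLaw_map_cons hπ _) _ hg hB]
  · refine integral_congr_ae (Filter.Eventually.of_forall fun s' => ?_)
    exact integral_map (hc s').aemeasurable hg.aestronglyMeasurable
  · intro s'
    have := isProbabilityMeasure_trajLaw (P := fun i => P i.succ) (fun i => hπ i.succ) s'
    exact Measure.isProbabilityMeasure_map (hc s').aemeasurable

end Succ

/-- The Markov property: given `(s_h, a_h)`, the next state has the law `P_h(· ∣ s_h, a_h)`. -/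
lemma lintegral_trajLaw_step {n : ℕ} {P : Fin n → Kernel (S × A) S} [∀ i, IsMarkovKernel (P i)]
    {π : Policy S A n} (hπ : ∀ i, Measurable (π i)) (s : S) (h : Fin n)
    {g : (S × A) × S → ℝ≥0∞} (hg : Measurable g) :
    ∫⁻ τ, g (τ h) ∂(trajLaw n P π s) =
      ∫⁻ τ, ∫⁻ s', g ((τ h).1, s') ∂(P h (τ h).1) ∂(trajLaw n P π s) := by
  induction n generalizing s with
  | zero => exact h.elim0
  | succ n ih =>
    have hin : Measurable fun x : S × A => ∫⁻ s', g (x, s') ∂(P h x) :=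
      measurable_lintegral_family (P h).measurable (fun _ => inferInstance) hg
    rw [lintegral_trajLaw_succ hπ s (g := fun τ => g (τ h)) (hg.comp (measurable_pi_apply h)),
      lintegral_trajLaw_succ hπ s (g := fun τ => ∫⁻ s', g ((τ h).1, s') ∂(P h (τ h).1))
        (hin.comp (measurable_fst.comp (measurable_pi_apply h)))]
    revert hin
    refine Fin.cases ?_ (fun j => ?_) h <;> intro hin
    · have : ∀ s', IsProbabilityMeasure
          (trajLaw n (fun i => P i.succ) (fun i => π i.succ) s') :=
        fun s' => isProbabilityMeasure_trajLaw (fun i => hπ i.succ) s'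
      simp
    · simp only [Fin.cons_succ]
      exact lintegral_congr fun s' => ih (fun i => hπ i.succ) s' j

end Trajectories

/-! ### Values of policies and telescoping of residuals -/

section Values

variable {S A : Type*} [MeasurableSpace S] [MeasurableSpace A]

/-- The expected total of `r_0(x_0) + ⋯ + r_{n-1}(x_{n-1})` along a trajectory from `s`. -/
def val (n : ℕ) (P : Fin n → Kernel (S × A) S) (r : Fin n → S × A → ℝ) (π : Policy S A n)
    (s : S) : ℝ :=
  ∫ τ, ∑ i, r i (τ i).1 ∂(trajLaw n P π s)

lemma measurable_sum_traj {n : ℕ} {r : Fin n → S × A → ℝ} (hr : ∀ i, Measurable (r i)) :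
    Measurable fun τ : Traj S A n => ∑ i, r i (τ i).1 :=
  Finset.measurable_sum _ fun i _ =>
    (hr i).comp (measurable_fst.comp (measurable_pi_apply i))

lemma abs_sum_traj_le {S A : Type*} {n : ℕ} {r : Fin n → S × A → ℝ} {B : ℝ}
    (hB : ∀ i x, |r i x| ≤ B) (τ : Traj S A n) : |∑ i, r i (τ i).1| ≤ n * B := by
  refine (Finset.abs_sum_le_sum_abs _ _).trans ?_
  refine (Finset.sum_le_sum fun i _ => hB i (τ i).1).trans ?_
  simp

lemma measurable_val {n : ℕ} {P : Fin n → Kernel (S × A) S} [∀ i, IsMarkovKernel (P i)]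
    {r : Fin n → S × A → ℝ} (hr : ∀ i, Measurable (r i)) {π : Policy S A n}
    (hπ : ∀ i, Measurable (π i)) : Measurable (val n P r π) :=
  measurable_integral_family (measurable_trajLaw hπ) (isProbabilityMeasure_trajLaw hπ)
    ((measurable_sum_traj hr).comp measurable_snd)

lemma abs_val_le {n : ℕ} {P : Fin n → Kernel (S × A) S} [∀ i, IsMarkovKernel (P i)]
    {r : Fin n → S × A → ℝ} {B : ℝ} (hB : ∀ i x, |r i x| ≤ B)
    {π : Policy S A n} (hπ : ∀ i, Measurable (π i)) (s : S) : |val n P r π s| ≤ n * B := by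
  have := isProbabilityMeasure_trajLaw (P := P) hπ s
  exact abs_integral_le_of_abs_le (abs_sum_traj_le hB)

lemma val_succ {n : ℕ} {P : Fin (n + 1) → Kernel (S × A) S} [∀ i, IsMarkovKernel (P i)]
    {r : Fin (n + 1) → S × A → ℝ} (hr : ∀ i, Measurable (r i)) {B : ℝ}
    (hB : ∀ i x, |r i x| ≤ B) {π : Policy S A (n + 1)} (hπ : ∀ i, Measurable (π i)) (s : S) :
    val (n + 1) P r π s = r 0 (s, π 0 s) +
      ∫ s', val n (fun i => P i.succ) (fun i => r i.succ) (fun i => π i.succ) s'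
        ∂(P 0 (s, π 0 s)) := by
  rw [val, integral_trajLaw_succ hπ s (measurable_sum_traj hr) (abs_sum_traj_le hB)]
  have hp : ∀ s', IsProbabilityMeasure
      (trajLaw n (fun i => P i.succ) (fun i => π i.succ) s') :=
    fun s' => isProbabilityMeasure_trajLaw (fun i => hπ i.succ) s'
  have hv := measurable_val (P := fun i => P i.succ) (r := fun i => r i.succ)
    (fun i => hr i.succ) (fun i => hπ i.succ)
  have h1 : ∀ s', ∫ τ, ∑ i, r i ((Fin.cons ((s, π 0 s), s') τ : Traj S A (n + 1)) i).1
      ∂(trajLaw n (fun i => P i.succ) (fun i => π i.succ) s') =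
      r 0 (s, π 0 s) + val n (fun i => P i.succ) (fun i => r i.succ) (fun i => π i.succ) s' := by
    intro s'
    simp only [Fin.sum_univ_succ, Fin.cons_zero, Fin.cons_succ]
    rw [integral_add (integrable_const _), val]
    · simp
    · exact integrable_of_abs_le (measurable_sum_traj fun i => hr i.succ)
        (abs_sum_traj_le fun i => hB i.succ)
  simp_rw [h1]
  rw [integral_add (integrable_const _)]
  · simp
  · exact integrable_of_abs_le hv (abs_val_le (fun i => hB i.succ) fun i => hπ i.succ)

/-- The difference between a tuple of functions, evaluated along a policy, and the value of that
policy is the expected sum of the residuals. -/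
lemma val_residual {n : ℕ} {P : Fin n → Kernel (S × A) S} [∀ i, IsMarkovKernel (P i)]
    {r : Fin n → S × A → ℝ} (hr : ∀ i, Measurable (r i)) {B : ℝ}
    (hB : ∀ i x, |r i x| ≤ B) {π : Policy S A n} (hπ : ∀ i, Measurable (π i))
    {q : Fin n → S × A → ℝ} (hq : ∀ i, Measurable (q i)) (hqB : ∀ i x, |q i x| ≤ B)
    {v : Fin (n + 1) → S → ℝ} (hv : ∀ i : Fin n, ∀ s, v i.castSucc s = q i (s, π i s))
    (hv0 : ∀ s, v (Fin.last n) s = 0) (s : S) :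
    val n P (fun i x => q i x - r i x - ∫ s', v i.succ s' ∂(P i x)) π s =
      v 0 s - val n P r π s := by
  induction n generalizing s with
  | zero =>
    have := hv0 s
    simp only [Fin.last_zero] at this
    simp [val, this]
  | succ n ih =>
    have hB0 : 0 ≤ B := (abs_nonneg _).trans (hB 0 (s, π 0 s))
    have hvm : ∀ i, Measurable (v i) := by
      refine Fin.lastCases ?_ (fun i => ?_)
      · rw [funext hv0]; exact measurable_const
      · rw [funext (hv i)]
        exact (hq i).comp (measurable_id.prodMk (hπ i))
    have hvB : ∀ i s, |v i s| ≤ B := by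
      refine Fin.lastCases ?_ (fun i => ?_) <;> intro s
      · rw [hv0]; simpa using hB0
      · rw [hv]; exact hqB _ _
    have hint : ∀ (i : Fin (n + 1)) (j : Fin (n + 2)),
        Measurable fun x => ∫ s', v j s' ∂(P i x) := fun i j =>
      measurable_integral_family (P i).measurable (fun _ => inferInstance)
        ((hvm j).comp measurable_snd)
    have hresm : ∀ i : Fin (n + 1),
        Measurable fun x => q i x - r i x - ∫ s', v i.succ s' ∂(P i x) :=
      fun i => ((hq i).sub (hr i)).sub (hint i i.succ)
    have hresB : ∀ (i : Fin (n + 1)) x, |q i x - r i x - ∫ s', v i.succ s' ∂(P i x)| ≤ 3 * B := by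
      intro i x
      have h1 : |∫ s', v i.succ s' ∂(P i x)| ≤ B := abs_integral_le_of_abs_le (hvB _)
      have h2 := abs_sub (q i x - r i x) (∫ s', v i.succ s' ∂(P i x))
      have h3 := abs_sub (q i x) (r i x)
      linarith [hqB i x, hB i x]
    rw [val_succ hresm hresB hπ s, val_succ hr hB hπ s]
    have ih' := ih (P := fun i => P i.succ) (r := fun i => r i.succ) (fun i => hr i.succ)
      (fun i => hB i.succ) (π := fun i => π i.succ) (fun i => hπ i.succ)
      (q := fun i => q i.succ) (fun i => hq i.succ) (fun i => hqB i.succ)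
      (v := fun i => v i.succ)
      (fun i s => by
        have := hv i.succ s
        rwa [← Fin.succ_castSucc] at this)
      (fun s => by
        rw [Fin.succ_last]; exact hv0 s)
    -- The expectation of `v 1` now occurs with both signs and cancels.
    simp_rw [ih']
    rw [integral_sub]
    · have := hv 0 s
      rw [Fin.castSucc_zero] at this
      rw [this]; ring
    · exact integrable_of_abs_le (hvm _) (hvB _)
    · exact integrable_of_abs_le (measurable_val (fun i => hr i.succ) fun i => hπ i.succ)
        (abs_val_le (fun i => hB i.succ) fun i => hπ i.succ)

end Values

/-! ### Maximal values and entries of tuples -/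

section Entries

variable {S A : Type*} {H : ℕ}

/-- The function `s ↦ max_a f(s, a)`. -/
def maxVal (f : S × A → ℝ) (s : S) : ℝ := ⨆ a, f (s, a)

lemma maxVal_eq_of_le {f : S × A → ℝ} {s : S} {a : A} (h : ∀ a', f (s, a') ≤ f (s, a)) :
    maxVal f s = f (s, a) := by
  have : Nonempty A := ⟨a⟩
  exact le_antisymm (ciSup_le h)
    (le_ciSup (f := fun a => f (s, a)) ⟨f (s, a), by rintro _ ⟨a', rfl⟩; exact h a'⟩ a)

lemma maxVal_zero (s : S) : maxVal (0 : S × A → ℝ) s = 0 := by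
  simp [maxVal]

lemma entry_of_lt (f : QTuple S A H) {j : ℕ} (hj : j < H) : entry f j = f ⟨j, hj⟩ := by
  simp [entry, hj]

lemma entry_of_not_lt (f : QTuple S A H) {j : ℕ} (hj : ¬ j < H) : entry f j = 0 := by
  simp [entry, hj]

lemma entry_mem_classAt {F : Fin H → Set (S × A → ℝ)} {f : QTuple S A H} (hf : f ∈ prodClass F)
    (j : ℕ) : entry f j ∈ classAt F j := by
  by_cases hj : j < H
  · simpa [entry, classAt, hj] using hf ⟨j, hj⟩ trivial
  · simp [entry, classAt, hj]

end Entries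

/-! ### Bellman equations and the policy loss decomposition -/

section Optimality

variable {S A : Type*} [MeasurableSpace S] [MeasurableSpace A] {H : ℕ}

instance (M : MDP S A H) (h : Fin H) : IsMarkovKernel (M.P h) := M.markov h

namespace MDP

variable (M : MDP S A H)

lemma V_eq_val (π : Policy S A H) (h : ℕ) (s : S) :
    M.V π h s = val (H - h) (fun i => M.P ⟨h + i, by omega⟩) (fun i => M.r ⟨h + i, by omega⟩)
      (fun i => π ⟨h + i, by omega⟩) s := rfl

lemma V_zero_eq_val (π : Policy S A H) (s : S) : M.V π 0 s = val H M.P M.r π s := by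
  have h0 : ∀ i : Fin H, (⟨0 + i, by omega⟩ : Fin H) = i := fun i => Fin.ext (by simp)
  have h1 : M.V π 0 s = val H (fun i : Fin H => M.P ⟨0 + i, by omega⟩)
    (fun i : Fin H => M.r ⟨0 + i, by omega⟩) (fun i : Fin H => π ⟨0 + i, by omega⟩) s := rfl
  rw [h1]
  simp only [h0]

lemma V_of_le (π : Policy S A H) {h : ℕ} (hh : H ≤ h) (s : S) : M.V π h s = 0 := by
  have h0 : H - h = 0 := by omega
  have : IsEmpty (Fin (H - h)) := by rw [h0]; infer_instance
  simp [V]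

lemma V_nonneg (π : Policy S A H) (h : ℕ) (s : S) : 0 ≤ M.V π h s :=
  integral_nonneg fun _ => Finset.sum_nonneg fun _ _ => M.r_nonneg _ _

variable {M}

lemma V_le_of_r_le {π : Policy S A H} (hπ : ∀ h, Measurable (π h)) {h : ℕ}
    (hr : ∀ j : Fin H, h ≤ j → ∀ x, M.r j x ≤ 1) (s : S) : M.V π h s ≤ (H - h : ℕ) := by
  rw [V_eq_val]
  refine (le_abs_self _).trans ((abs_val_le (B := 1) (fun i x => ?_) (fun i => hπ _) s).trans ?_)
  · rw [abs_of_nonneg (M.r_nonneg _ _)]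
    exact hr _ (by simp) x
  · simp

/-- Realizability bounds the rewards: `r_h ≤ Q^⋆_h ≤ 1`. -/
lemma r_le_one {π : Policy S A H} (hπ : ∀ h, Measurable (π h))
    (hQ : ∀ h x, M.Qstar h x ≤ 1) (h : Fin H) (x : S × A) : M.r h x ≤ 1 := by
  -- Backward induction on the step. A real supremum over an unbounded family is `0`, so `r_h ≤
  -- Q^⋆_h` requires the values to be bounded above; the bound on the later rewards supplies this.
  suffices H' : ∀ n, ∀ h : Fin H, H ≤ h + 1 + n → ∀ x, M.r h x ≤ 1 from
    H' H h (by omega) x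
  intro n
  induction n with
  | zero =>
    intro h hh x
    refine le_trans ?_ (hQ h x)
    have hq : ∀ π : Policy S A H, M.Q π h x = M.r h x := fun π => by
      rw [Q]; simp [V_of_le M π hh]
    have : Nonempty {π : Policy S A H // ∀ h, Measurable (π h)} := ⟨⟨π, hπ⟩⟩
    rw [Qstar]
    simp [hq]
  | succ n ih =>
    intro h hh x
    refine le_trans ?_ (hQ h x)
    have hV : ∀ π : {π : Policy S A H // ∀ h, Measurable (π h)}, ∀ s,
        M.V π.1 (h + 1) s ≤ (H - (h + 1) : ℕ) := fun π s =>
      V_le_of_r_le π.2 (fun j hj y => ih j (by omega) y) s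
    have hbdd : BddAbove (Set.range fun π : {π : Policy S A H // ∀ h, Measurable (π h)} =>
        M.Q π.1 h x) := by
      refine ⟨M.r h x + (H - (h + 1) : ℕ), ?_⟩
      rintro _ ⟨π, rfl⟩
      simp only [Q]
      gcongr
      refine (le_abs_self _).trans (abs_integral_le_of_abs_le fun s => ?_)
      rw [abs_of_nonneg (M.V_nonneg _ _ _)]
      exact hV π s
    refine le_trans ?_ (le_ciSup hbdd ⟨π, hπ⟩)
    simp only [Q]
    linarith [integral_nonneg (μ := M.P h x) (f := M.V π (h + 1)) fun s => M.V_nonneg π _ s]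

lemma abs_r_le_one (hr : ∀ h x, M.r h x ≤ 1) (h : Fin H) (x : S × A) : |M.r h x| ≤ 1 := by
  rw [abs_of_nonneg (M.r_nonneg _ _)]; exact hr h x

lemma measurable_V {π : Policy S A H} (hπ : ∀ h, Measurable (π h)) (h : ℕ) :
    Measurable (M.V π h) :=
  measurable_val (fun _ => M.measurable_r _) (fun _ => hπ _)

lemma abs_V_le (hr : ∀ h x, M.r h x ≤ 1) {π : Policy S A H} (hπ : ∀ h, Measurable (π h)) (h : ℕ)
    (s : S) : |M.V π h s| ≤ H := by
  rw [abs_of_nonneg (M.V_nonneg _ _ _)]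
  refine (V_le_of_r_le hπ (fun j _ x => hr j x) s).trans ?_
  exact_mod_cast Nat.sub_le _ _

/-- The length enters through an equation so that it applies to `H - h`, which is only
propositionally a successor. -/
lemma val_eq_add {m n : ℕ} (hm : m = n + 1) {P : Fin m → Kernel (S × A) S}
    [∀ i, IsMarkovKernel (P i)]
    {r : Fin m → S × A → ℝ} (hr : ∀ i, Measurable (r i)) {B : ℝ}
    (hB : ∀ i x, |r i x| ≤ B) {π : Policy S A m} (hπ : ∀ i, Measurable (π i)) (s : S) :
    val m P r π s = r ⟨0, by omega⟩ (s, π ⟨0, by omega⟩ s) +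
      ∫ s', val n (fun i => P ⟨i + 1, by omega⟩) (fun i => r ⟨i + 1, by omega⟩)
        (fun i => π ⟨i + 1, by omega⟩) s'
        ∂(P ⟨0, by omega⟩ (s, π ⟨0, by omega⟩ s)) := by
  subst hm
  exact val_succ hr hB hπ s

/-- The Bellman equation of a policy. -/
lemma V_eq_Q (hr : ∀ h x, M.r h x ≤ 1) {π : Policy S A H} (hπ : ∀ h, Measurable (π h))
    (h : Fin H) (s : S) : M.V π h s = M.Q π h (s, π h s) := by
  rw [V_eq_val, val_eq_add (n := H - (h + 1)) (by omega) (fun i => M.measurable_r _)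
    (fun i x => abs_r_le_one hr _ x) (fun i => hπ _), Q]
  have h1 : ∀ s', M.V π (h + 1) s' = val (H - (h + 1))
      (fun i => M.P ⟨h + (i + 1), by omega⟩) (fun i => M.r ⟨h + (i + 1), by omega⟩)
      (fun i => π ⟨h + (i + 1), by omega⟩) s' := by
    intro s'
    have h2 : ∀ i : Fin (H - (h + 1)),
        (⟨h + 1 + i, by omega⟩ : Fin H) = ⟨h + (i + 1), by omega⟩ :=
      fun i => Fin.ext (by simp; omega)
    rw [V_eq_val]
    simp only [h2]
  simp only [h1]
  rfl

lemma Q_le_Qstar (hr : ∀ h x, M.r h x ≤ 1) {π : Policy S A H} (hπ : ∀ h, Measurable (π h))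
    (h : Fin H) (x : S × A) : M.Q π h x ≤ M.Qstar h x := by
  refine le_ciSup (f := fun π : {π : Policy S A H // ∀ h, Measurable (π h)} => M.Q π.1 h x)
    ⟨1 + H, ?_⟩ ⟨π, hπ⟩
  rintro _ ⟨π, rfl⟩
  exact add_le_add (hr h x)
    ((le_abs_self _).trans (abs_integral_le_of_abs_le fun s => abs_V_le hr π.2 _ s))

/-- A policy that is greedy for `Q^⋆` attains `Q^⋆`. -/
lemma Qstar_eq_Q (hr : ∀ h x, M.r h x ≤ 1) {π : Policy S A H} (hπ : ∀ h, Measurable (π h))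
    (hmax : ∀ h s a, M.Qstar h (s, a) ≤ M.Qstar h (s, π h s)) (h : Fin H) (x : S × A) :
    M.Qstar h x = M.Q π h x := by
  -- Backward induction. At the next step every policy `ρ` satisfies `V^ρ(s) = Q^ρ(s, ρ s) ≤ Q^⋆(s,
  -- ρ s) ≤ Q^⋆(s, π s)`, and the last term is `V^π(s)` by the induction hypothesis.
  suffices H' : ∀ n, ∀ h : Fin H, H ≤ h + 1 + n → ∀ x, M.Qstar h x = M.Q π h x from
    H' H h (by omega) x
  intro n
  have hne : Nonempty {π : Policy S A H // ∀ h, Measurable (π h)} := ⟨⟨π, hπ⟩⟩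
  induction n with
  | zero =>
    intro h hh x
    have hq : ∀ π : Policy S A H, M.Q π h x = M.r h x := fun π => by
      rw [Q]; simp [V_of_le M π hh]
    rw [Qstar]
    simp [hq]
  | succ n ih =>
    intro h hh x
    refine le_antisymm (ciSup_le fun ρ => ?_) (Q_le_Qstar hr hπ h x)
    simp only [Q]
    gcongr 1
    refine integral_mono (integrable_of_abs_le (measurable_V ρ.2 _) (abs_V_le hr ρ.2 _))
      (integrable_of_abs_le (measurable_V hπ _) (abs_V_le hr hπ _)) fun s => ?_
    by_cases hlt : (h : ℕ) + 1 < H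
    · have e1 := V_eq_Q hr ρ.2 ⟨h + 1, hlt⟩ s
      have e2 := V_eq_Q hr hπ ⟨h + 1, hlt⟩ s
      simp only at e1 e2 ⊢
      rw [e1, e2, ← ih ⟨h + 1, hlt⟩ (by simp; omega)]
      exact (Q_le_Qstar hr ρ.2 _ _).trans (hmax _ _ _)
    · simp only [V_of_le M _ (not_lt.1 hlt), le_refl]

lemma bellman_eq (h : Fin H) (f : S × A → ℝ) (x : S × A) :
    M.bellman h f x = M.r h x + ∫ s', maxVal f s' ∂(M.P h x) := rfl

/-- The Bellman optimality equation. -/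
lemma bellman_Qstar (hr : ∀ h x, M.r h x ≤ 1) {π : Policy S A H} (hπ : ∀ h, Measurable (π h))
    (hmax : ∀ h s a, M.Qstar h (s, a) ≤ M.Qstar h (s, π h s)) (h : Fin H) :
    M.bellman h (entry M.Qstar (h + 1)) = M.Qstar h := by
  funext x
  rw [Qstar_eq_Q hr hπ hmax h x, bellman_eq, Q]
  congr 2
  funext s
  by_cases hlt : (h : ℕ) + 1 < H
  · rw [entry_of_lt _ hlt, maxVal_eq_of_le (hmax ⟨h + 1, hlt⟩ s), Qstar_eq_Q hr hπ hmax]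
    exact (V_eq_Q hr hπ ⟨h + 1, hlt⟩ s).symm
  · rw [entry_of_not_lt _ hlt, V_of_le M _ (not_lt.1 hlt), maxVal_zero]

lemma Vstar_le [NeZero H] (hr : ∀ h x, M.r h x ≤ 1) {π : Policy S A H}
    (hπ : ∀ h, Measurable (π h))
    (hmax : ∀ h s a, M.Qstar h (s, a) ≤ M.Qstar h (s, π h s)) (s : S) :
    M.Vstar 0 s ≤ M.Qstar 0 (s, π 0 s) := by
  have hne : Nonempty {π : Policy S A H // ∀ h, Measurable (π h)} := ⟨⟨π, hπ⟩⟩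
  refine ciSup_le fun ρ => ?_
  have := V_eq_Q hr ρ.2 0 s
  simp only [Fin.val_zero] at this
  rw [this]
  exact (Q_le_Qstar hr ρ.2 _ _).trans (hmax _ _ _)

/-- The Bellman residual `f_h - T_h f_{h+1}`. -/
def resid (M : MDP S A H) (f : QTuple S A H) (h : Fin H) (x : S × A) : ℝ :=
  f h x - M.bellman h (entry f (h + 1)) x

/-- The law of `(s_h, a_h)` under a policy. -/
def occ (M : MDP S A H) (π : Policy S A H) (h : Fin H) : Measure (S × A) :=
  (trajLaw H M.P π M.s₁).map fun τ => (τ h).1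

lemma isProbabilityMeasure_occ {π : Policy S A H} (hπ : ∀ h, Measurable (π h)) (h : Fin H) :
    IsProbabilityMeasure (M.occ π h) := by
  have := isProbabilityMeasure_trajLaw (P := M.P) hπ M.s₁
  exact Measure.isProbabilityMeasure_map
    (measurable_fst.comp (measurable_pi_apply h)).aemeasurable

lemma integral_occ {π : Policy S A H} (h : Fin H) {g : S × A → ℝ} (hg : Measurable g) :
    ∫ x, g x ∂(M.occ π h) = ∫ τ, g (τ h).1 ∂(trajLaw H M.P π M.s₁) :=
  integral_map (measurable_fst.comp (measurable_pi_apply h)).aemeasurable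
    hg.aestronglyMeasurable

lemma measurable_maxVal_entry {f : QTuple S A H} (hf : ∀ h, Measurable (f h))
    {π : Policy S A H} (hπ : ∀ h, Measurable (π h))
    (hmax : ∀ h s a, f h (s, a) ≤ f h (s, π h s)) (j : ℕ) : Measurable (maxVal (entry f j)) := by
  by_cases hj : j < H
  · have : maxVal (f ⟨j, hj⟩) = fun s => f ⟨j, hj⟩ (s, π ⟨j, hj⟩ s) :=
      funext fun s => maxVal_eq_of_le (hmax ⟨j, hj⟩ s)
    rw [entry_of_lt _ hj, this]
    exact (hf _).comp (measurable_id.prodMk (hπ _))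
  · rw [entry_of_not_lt _ hj, show maxVal (0 : S × A → ℝ) = fun _ => 0 from funext maxVal_zero]
    exact measurable_const

lemma maxVal_entry_mem_Icc {S A : Type*} {H : ℕ} {f : QTuple S A H} (hf : ∀ h x, f h x ∈ Set.Icc (0 : ℝ) 1)
    {π : Policy S A H}
    (hmax : ∀ h s a, f h (s, a) ≤ f h (s, π h s)) (j : ℕ) (s : S) :
    maxVal (entry f j) s ∈ Set.Icc (0 : ℝ) 1 := by
  by_cases hj : j < H
  · rw [entry_of_lt _ hj, maxVal_eq_of_le (hmax ⟨j, hj⟩ s)]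
    exact hf _ _
  · rw [entry_of_not_lt _ hj, maxVal_zero]
    simp

lemma measurable_bellman {h : Fin H} {f : S × A → ℝ} (hf : Measurable (maxVal f)) :
    Measurable (M.bellman h f) :=
  (M.measurable_r h).add (measurable_integral_family (M.P h).measurable (fun _ => inferInstance)
    (hf.comp measurable_snd))

/-- The policy loss decomposition for a greedy policy. -/
lemma sub_V_eq_sum_integral_resid [NeZero H] (hr : ∀ h x, M.r h x ≤ 1) {f : QTuple S A H}
    (hf : ∀ h, Measurable (f h))
    (hf01 : ∀ h x, f h x ∈ Set.Icc (0 : ℝ) 1) {π : Policy S A H} (hπ : ∀ h, Measurable (π h))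
    (hmax : ∀ h s a, f h (s, a) ≤ f h (s, π h s)) :
    f 0 (M.s₁, π 0 M.s₁) - M.V π 0 M.s₁ = ∑ h, ∫ x, M.resid f h x ∂(M.occ π h) := by
  have hprob := isProbabilityMeasure_trajLaw (P := M.P) hπ M.s₁
  have hfB : ∀ h x, |f h x| ≤ 1 := fun h x => by
    rw [abs_of_nonneg (hf01 h x).1]; exact (hf01 h x).2
  have hmv := measurable_maxVal_entry hf hπ hmax
  have hresm : ∀ h, Measurable (M.resid f h) := fun h => (hf h).sub (measurable_bellman (hmv _))
  have hmvB : ∀ j s, |maxVal (entry f j) s| ≤ 1 := fun j s => by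
    have := maxVal_entry_mem_Icc hf01 hmax j s
    rw [abs_of_nonneg this.1]; exact this.2
  have hresB : ∀ h x, |M.resid f h x| ≤ 3 := by
    intro h x
    have h1 : |∫ s', maxVal (entry f (h + 1)) s' ∂(M.P h x)| ≤ 1 :=
      abs_integral_le_of_abs_le (hmvB _)
    rw [resid, bellman_eq]
    have h2 := hfB h x
    have h3 := abs_r_le_one hr h x
    rw [abs_le] at h1 h2 h3 ⊢
    constructor <;> linarith [h1.1, h1.2, h2.1, h2.2, h3.1, h3.2]
  have key := val_residual (P := M.P) M.measurable_r (abs_r_le_one hr) hπ hf hfB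
    (v := fun i => maxVal (entry f i))
    (fun i s => by
      rw [Fin.val_castSucc, entry_of_lt _ i.2]
      exact maxVal_eq_of_le (hmax i s))
    (fun s => by
      rw [Fin.val_last, entry_of_not_lt _ (lt_irrefl H), maxVal_zero]) M.s₁
  rw [V_zero_eq_val]
  have h0 : maxVal (entry f 0) M.s₁ = f 0 (M.s₁, π 0 M.s₁) := by
    rw [entry_of_lt _ (NeZero.pos H)]
    exact maxVal_eq_of_le (hmax 0 M.s₁)
  simp only [Fin.val_zero, h0] at key
  rw [← key, val, integral_finsetSum]
  · refine Finset.sum_congr rfl fun h _ => ?_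
    rw [integral_occ h (hresm h)]
    refine integral_congr_ae (Filter.Eventually.of_forall fun τ => ?_)
    simp only [resid, bellman_eq, Fin.val_succ]
    ring
  · intro h _
    have : (fun τ : Traj S A H => f h (τ h).1 - M.r h (τ h).1 -
        ∫ s', maxVal (entry f (h.succ : ℕ)) s' ∂(M.P h (τ h).1)) =
        fun τ => M.resid f h (τ h).1 := by
      funext τ
      simp only [resid, bellman_eq, Fin.val_succ]
      ring
    rw [this]
    exact integrable_of_abs_le ((hresm h).comp (measurable_fst.comp (measurable_pi_apply h)))
      fun τ => hresB h _

end MDP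

end Optimality

/-! ### The law of the whole run and exponential supermartingales -/

namespace MDP

variable {S A : Type*} [MeasurableSpace S] [MeasurableSpace A] {H : ℕ} {M : MDP S A H}
  {pol : (t : ℕ) → (Fin t → Traj S A H) → Policy S A H}

/-- The policy of each of the first `K` episodes depends measurably on the data. -/
def MeasurablePol (pol : (t : ℕ) → (Fin t → Traj S A H) → Policy S A H) (K : ℕ) : Prop :=
  ∀ k < K, ∀ h, Measurable fun p : (Fin k → Traj S A H) × S => pol k p.1 h p.2

lemma MeasurablePol.measurable {K : ℕ} (hpol : MeasurablePol pol K) {k : ℕ} (hk : k < K)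
    (D : Fin k → Traj S A H) (h : Fin H) : Measurable (pol k D h) :=
  (hpol k hk h).comp measurable_prodMk_left

lemma MeasurablePol.isProbabilityMeasure {K : ℕ} (hpol : MeasurablePol pol K) {k : ℕ}
    (hk : k < K) (D : Fin k → Traj S A H) :
    IsProbabilityMeasure (trajLaw H M.P (pol k D) M.s₁) :=
  isProbabilityMeasure_trajLaw (hpol.measurable hk D) _

lemma MeasurablePol.measurable_trajLaw {K : ℕ} (hpol : MeasurablePol pol K) {k : ℕ}
    (hk : k < K) : Measurable fun D : Fin k → Traj S A H => trajLaw H M.P (pol k D) M.s₁ :=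
  measurable_trajLaw_param (hpol k hk) _

lemma MeasurablePol.measurable_snoc {K : ℕ} (hpol : MeasurablePol pol K) {k : ℕ}
    (hk : k < K) : Measurable fun D : Fin k → Traj S A H =>
      (trajLaw H M.P (pol k D) M.s₁).map (Fin.snoc (α := fun _ => Traj S A H) D) :=
  measurable_map_family (hpol.measurable_trajLaw hk) (hpol.isProbabilityMeasure hk)
    (F := fun D => Fin.snoc (α := fun _ => Traj S A H) D) measurable_fin_snoc

lemma measurable_snoc_left {k : ℕ} (D : Fin k → Traj S A H) :
    Measurable (Fin.snoc (α := fun _ => Traj S A H) D) :=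
  measurable_fin_snoc.comp measurable_prodMk_left

lemma isProbabilityMeasure_runLaw {K : ℕ} (hpol : MeasurablePol pol K) {k : ℕ} (hk : k ≤ K) :
    IsProbabilityMeasure (M.runLaw pol k) := by
  induction k with
  | zero => rw [runLaw]; infer_instance
  | succ k ih =>
    have := ih (by omega)
    refine isProbabilityMeasure_bind (hpol.measurable_snoc hk) fun D => ?_
    have := hpol.isProbabilityMeasure (M := M) hk D
    exact Measure.isProbabilityMeasure_map (measurable_snoc_left D).aemeasurable

lemma lintegral_runLaw_succ {K : ℕ} (hpol : MeasurablePol pol K) {k : ℕ} (hk : k < K)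
    {g : (Fin (k + 1) → Traj S A H) → ℝ≥0∞} (hg : Measurable g) :
    ∫⁻ D, g D ∂(M.runLaw pol (k + 1)) =
      ∫⁻ D, ∫⁻ τ, g (Fin.snoc D τ) ∂(trajLaw H M.P (pol k D) M.s₁) ∂(M.runLaw pol k) := by
  rw [runLaw, Measure.lintegral_bind (hpol.measurable_snoc hk).aemeasurable hg.aemeasurable]
  exact lintegral_congr fun D => lintegral_map hg (measurable_snoc_left D)

/-- The data of the first `n` of `K` episodes. -/
def pre {X : Type*} {K : ℕ} (D : Fin K → X) (n : ℕ) (hn : n ≤ K) : Fin n → X :=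
  fun i => D (Fin.castLE hn i)

lemma measurable_pre {X : Type*} [MeasurableSpace X] {K n : ℕ} (hn : n ≤ K) :
    Measurable fun D : Fin K → X => pre D n hn :=
  measurable_pi_iff.2 fun _ => measurable_pi_apply _

lemma pre_snoc {X : Type*} {k n : ℕ} (hn : n ≤ k) (D : Fin k → X) (x : X) :
    pre (Fin.snoc D x : Fin (k + 1) → X) n (hn.trans k.le_succ) = pre D n hn := by
  funext i
  exact Fin.snoc_castSucc (α := fun _ => X) x D (Fin.castLE hn i)

/-- The later episodes integrate out with total mass one. -/
lemma lintegral_runLaw_pre {K : ℕ} (hpol : MeasurablePol pol K) {k n : ℕ} (hn : n ≤ k)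
    (hk : k ≤ K) {g : (Fin n → Traj S A H) → ℝ≥0∞} (hg : Measurable g) :
    ∫⁻ D, g (pre D n hn) ∂(M.runLaw pol k) = ∫⁻ D, g D ∂(M.runLaw pol n) := by
  induction k, hn using Nat.le_induction with
  | base => rfl
  | succ k hnk ih =>
    rw [lintegral_runLaw_succ hpol hk (g := fun D => g (pre D n (hnk.trans k.le_succ)))
      (hg.comp (measurable_pre _)), ← ih (by omega)]
    refine lintegral_congr fun D => ?_
    have := hpol.isProbabilityMeasure (M := M) hk D
    simp only [pre_snoc hnk]
    simp

/-- The sum of `ψ_t(D_0, …, D_{t-1}; D_t)` over the episodes. -/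
def cumSum {X : Type*} (ψ : (t : ℕ) → (Fin t → X) → X → ℝ) {n : ℕ} (D : Fin n → X) : ℝ :=
  ∑ t : Fin n, ψ t (pre D t t.isLt.le) (D t)

lemma cumSum_snoc {X : Type*} (ψ : (t : ℕ) → (Fin t → X) → X → ℝ) {n : ℕ} (D : Fin n → X)
    (x : X) : cumSum ψ (Fin.snoc D x : Fin (n + 1) → X) = cumSum ψ D + ψ n D x := by
  rw [cumSum, Fin.sum_univ_castSucc, cumSum]
  congr 1
  · refine Finset.sum_congr rfl fun t _ => ?_
    congr 1
    · exact pre_snoc t.isLt.le D x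
    · exact Fin.snoc_castSucc (α := fun _ => X) x D t
  · congr 1
    · exact pre_snoc le_rfl D x
    · exact Fin.snoc_last (α := fun _ => X) x D

lemma measurable_cumSum {X : Type*} [MeasurableSpace X] {ψ : (t : ℕ) → (Fin t → X) → X → ℝ}
    {n : ℕ} (hψ : ∀ t < n, Measurable fun p : (Fin t → X) × X => ψ t p.1 p.2) :
    Measurable fun D : Fin n → X => cumSum ψ D :=
  Finset.measurable_sum _ fun t _ =>
    (hψ t t.2).comp ((measurable_pre t.isLt.le).prodMk (measurable_pi_apply t))

/-- Given the earlier data, the factor of the last episode has mean at most one; integrating it out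
first lowers `n` by one. -/
lemma lintegral_exp_cumSum_le {K : ℕ} (hpol : MeasurablePol pol K)
    {ψ : (t : ℕ) → (Fin t → Traj S A H) → Traj S A H → ℝ}
    (hψ : ∀ t < K, Measurable fun p : (Fin t → Traj S A H) × Traj S A H => ψ t p.1 p.2)
    (hle : ∀ t < K, ∀ D, ∫⁻ τ, ENNReal.ofReal (Real.exp (ψ t D τ))
      ∂(trajLaw H M.P (pol t D) M.s₁) ≤ 1) {n : ℕ} (hn : n ≤ K) :
    ∫⁻ D, ENNReal.ofReal (Real.exp (cumSum ψ D)) ∂(M.runLaw pol n) ≤ 1 := by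
  have hm : ∀ n ≤ K, Measurable fun D : Fin n → Traj S A H =>
      ENNReal.ofReal (Real.exp (cumSum ψ D)) := fun n hn =>
    (Real.measurable_exp.comp
      (measurable_cumSum fun t ht => hψ t (by omega))).ennreal_ofReal
  induction n with
  | zero =>
    have := isProbabilityMeasure_runLaw (M := M) hpol hn
    simp [cumSum]
  | succ n ih =>
    rw [lintegral_runLaw_succ hpol hn (hm _ hn)]
    refine le_trans (lintegral_mono fun D => ?_) (ih (by omega))
    simp only [cumSum_snoc, Real.exp_add, ENNReal.ofReal_mul (Real.exp_nonneg _)]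
    rw [lintegral_const_mul]
    · exact mul_le_of_le_one_right zero_le (hle n hn D)
    · exact (Real.measurable_exp.comp ((hψ n hn).comp measurable_prodMk_left)).ennreal_ofReal

/-- An exponential supermartingale exceeds `e^L` with probability at most `e^{-L}`. -/
lemma runLaw_cumSum_ge_le {K : ℕ} (hpol : MeasurablePol pol K)
    {ψ : (t : ℕ) → (Fin t → Traj S A H) → Traj S A H → ℝ}
    (hψ : ∀ t < K, Measurable fun p : (Fin t → Traj S A H) × Traj S A H => ψ t p.1 p.2)
    (hle : ∀ t < K, ∀ D, ∫⁻ τ, ENNReal.ofReal (Real.exp (ψ t D τ))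
      ∂(trajLaw H M.P (pol t D) M.s₁) ≤ 1) {n : ℕ} (hn : n ≤ K) (L : ℝ) :
    M.runLaw pol K {D | L ≤ cumSum ψ (pre D n hn)} ≤ ENNReal.ofReal (Real.exp (-L)) := by
  have hm : Measurable fun D : Fin n → Traj S A H =>
      ENNReal.ofReal (Real.exp (cumSum ψ D)) :=
    (Real.measurable_exp.comp
      (measurable_cumSum fun t ht => hψ t (by omega))).ennreal_ofReal
  have h1 : ∫⁻ D, ENNReal.ofReal (Real.exp (cumSum ψ (pre D n hn))) ∂(M.runLaw pol K) ≤ 1 := by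
    rw [lintegral_runLaw_pre hpol hn le_rfl hm]
    exact lintegral_exp_cumSum_le hpol hψ hle hn
  have h2 := mul_meas_ge_le_lintegral (μ := M.runLaw pol K) (hm.comp (measurable_pre hn))
    (ENNReal.ofReal (Real.exp L))
  have h3 : {D : Fin K → Traj S A H | L ≤ cumSum ψ (pre D n hn)} ⊆
      {D | ENNReal.ofReal (Real.exp L) ≤
        ((fun D => ENNReal.ofReal (Real.exp (cumSum ψ D))) ∘ fun D => pre D n hn) D} := by
    intro D hD
    exact ENNReal.ofReal_le_ofReal (Real.exp_le_exp.2 hD)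
  have h4 : ENNReal.ofReal (Real.exp (-L)) * ENNReal.ofReal (Real.exp L) = 1 := by
    rw [← ENNReal.ofReal_mul (Real.exp_nonneg _), ← Real.exp_add]
    simp
  calc M.runLaw pol K {D | L ≤ cumSum ψ (pre D n hn)}
      = ENNReal.ofReal (Real.exp (-L)) * (ENNReal.ofReal (Real.exp L) *
        M.runLaw pol K {D | L ≤ cumSum ψ (pre D n hn)}) := by rw [← mul_assoc, h4, one_mul]
    _ ≤ ENNReal.ofReal (Real.exp (-L)) * 1 := by
        gcongr
        exact (mul_le_mul_right (measure_mono h3) _).trans (h2.trans h1)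
    _ = _ := mul_one _

end MDP

/-- Hoeffding's lemma, for the Lebesgue integral. -/
lemma lintegral_exp_mul_sub_integral_le {α : Type*} [MeasurableSpace α] {μ : Measure α}
    [IsProbabilityMeasure μ] {v : α → ℝ} (hv : Measurable v) {a b : ℝ}
    (hab : ∀ x, v x ∈ Set.Icc a b) (t : ℝ) :
    ∫⁻ x, ENNReal.ofReal (Real.exp (t * (v x - ∫ y, v y ∂μ))) ∂μ ≤
      ENNReal.ofReal (Real.exp (t ^ 2 * (b - a) ^ 2 / 8)) := by
  have h := hasSubgaussianMGF_of_mem_Icc hv.aemeasurable (μ := μ) (Filter.Eventually.of_forall hab)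
  rw [← ofReal_integral_eq_lintegral_ofReal (h.integrable_exp_mul t)
    (Filter.Eventually.of_forall fun x => Real.exp_nonneg _)]
  refine ENNReal.ofReal_le_ofReal ((h.mgf_le t).trans (Real.exp_le_exp.2 (le_of_eq ?_)))
  simp only [NNReal.coe_pow, NNReal.coe_div, coe_nnnorm, NNReal.coe_ofNat, div_pow,
    Real.norm_eq_abs, sq_abs]
  ring

/-! ### Exponential moments of the excess loss -/

namespace MDP

variable {S A : Type*} [MeasurableSpace S] [MeasurableSpace A] {H : ℕ} {M : MDP S A H}

/-- The regression target `r_h(x) + E_{s' ∼ P_h(· ∣ x)} v(s')`. -/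
def target (M : MDP S A H) (h : Fin H) (v : S → ℝ) (x : S × A) : ℝ :=
  M.r h x + ∫ s', v s' ∂(M.P h x)

/-- The distance of `u` from the regression target. -/
def gap (M : MDP S A H) (h : Fin H) (u : S × A → ℝ) (v : S → ℝ) (x : S × A) : ℝ :=
  u x - M.target h v x

/-- The excess of the squared loss of `u` over that of the regression target. -/
def excess (M : MDP S A H) (h : Fin H) (u : S × A → ℝ) (v : S → ℝ) (y : (S × A) × S) : ℝ :=
  (u y.1 - M.r h y.1 - v y.2) ^ 2 - (M.target h v y.1 - M.r h y.1 - v y.2) ^ 2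

lemma measurable_target {h : Fin H} {v : S → ℝ} (hv : Measurable v) :
    Measurable (M.target h v) :=
  (M.measurable_r h).add (measurable_integral_family (M.P h).measurable (fun _ => inferInstance)
    (hv.comp measurable_snd))

lemma measurable_gap {h : Fin H} {u : S × A → ℝ} {v : S → ℝ} (hu : Measurable u)
    (hv : Measurable v) : Measurable (M.gap h u v) :=
  hu.sub (measurable_target hv)

lemma measurable_excess {h : Fin H} {u : S × A → ℝ} {v : S → ℝ} (hu : Measurable u)
    (hv : Measurable v) : Measurable (M.excess h u v) := by
  have h1 : Measurable fun y : (S × A) × S => u y.1 := hu.comp measurable_fst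
  have h2 : Measurable fun y : (S × A) × S => M.r h y.1 := (M.measurable_r h).comp measurable_fst
  have h3 : Measurable fun y : (S × A) × S => v y.2 := hv.comp measurable_snd
  have h4 : Measurable fun y : (S × A) × S => M.target h v y.1 :=
    (measurable_target hv).comp measurable_fst
  exact (((h1.sub h2).sub h3).pow_const 2).sub (((h4.sub h2).sub h3).pow_const 2)

/-- The last factor is centred given `(s_h, a_h)`, so the excess has conditional mean `gap ^ 2`. -/
lemma excess_eq (h : Fin H) (u : S × A → ℝ) (v : S → ℝ) (y : (S × A) × S) :
    M.excess h u v y = M.gap h u v y.1 ^ 2 +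
      2 * M.gap h u v y.1 * ((∫ s', v s' ∂(M.P h y.1)) - v y.2) := by
  simp only [excess, gap, target]
  ring

/-- Hoeffding's lemma with tilt `2Δ` and range one costs `(2Δ)² / 8 = Δ² / 2`, half of the drift
`Δ²`. -/
lemma lintegral_exp_neg_excess_le (h : Fin H) (u : S × A → ℝ) {v : S → ℝ} (hv : Measurable v)
    (hv01 : ∀ s, v s ∈ Set.Icc (0 : ℝ) 1) (x : S × A) :
    ∫⁻ s', ENNReal.ofReal (Real.exp (-M.excess h u v (x, s'))) ∂(M.P h x) ≤
      ENNReal.ofReal (Real.exp (-(M.gap h u v x ^ 2 / 2))) := by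
  set Δ := M.gap h u v x
  have h1 : ∀ s', Real.exp (-M.excess h u v (x, s')) =
      Real.exp (-Δ ^ 2) * Real.exp (2 * Δ * (v s' - ∫ s'', v s'' ∂(M.P h x))) := by
    intro s'
    rw [← Real.exp_add, excess_eq]
    congr 1
    ring
  simp_rw [h1, ENNReal.ofReal_mul (Real.exp_nonneg _)]
  rw [lintegral_const_mul]
  · refine (mul_le_mul_right (lintegral_exp_mul_sub_integral_le hv hv01 (2 * Δ)) _).trans ?_
    rw [← ENNReal.ofReal_mul (Real.exp_nonneg _), ← Real.exp_add]
    refine ENNReal.ofReal_le_ofReal (Real.exp_le_exp.2 (le_of_eq ?_))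
    ring
  · exact (Real.measurable_exp.comp ((hv.sub_const _).const_mul _)).ennreal_ofReal

lemma lintegral_exp_empirical_le {π : Policy S A H} (hπ : ∀ h, Measurable (π h)) (h : Fin H)
    {u : S × A → ℝ} (hu : Measurable u) {v : S → ℝ} (hv : Measurable v)
    (hv01 : ∀ s, v s ∈ Set.Icc (0 : ℝ) 1) :
    ∫⁻ τ, ENNReal.ofReal (Real.exp (M.gap h u v (τ h).1 ^ 2 / 2 - M.excess h u v (τ h)))
      ∂(trajLaw H M.P π M.s₁) ≤ 1 := by
  have := isProbabilityMeasure_trajLaw (P := M.P) hπ M.s₁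
  have hg := measurable_gap (M := M) (h := h) hu hv
  have hX := measurable_excess (M := M) (h := h) hu hv
  rw [lintegral_trajLaw_step hπ M.s₁ h (g := fun y => ENNReal.ofReal (Real.exp
    (M.gap h u v y.1 ^ 2 / 2 - M.excess h u v y)))]
  · refine (lintegral_mono (g := fun _ => 1) fun τ => ?_).trans (by simp)
    simp only [sub_eq_add_neg, Real.exp_add, ENNReal.ofReal_mul (Real.exp_nonneg _)]
    rw [lintegral_const_mul]
    · refine (mul_le_mul_right (lintegral_exp_neg_excess_le h u hv hv01 (τ h).1) _).trans ?_
      rw [← ENNReal.ofReal_mul (Real.exp_nonneg _), ← Real.exp_add]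
      simp
    · exact (Real.measurable_exp.comp (hX.comp measurable_prodMk_left).neg).ennreal_ofReal
  · exact (Real.measurable_exp.comp
      ((((hg.comp measurable_fst).pow_const 2).div_const 2).sub hX)).ennreal_ofReal

/-- From `1 + u ≤ exp u` and `(1 + u)(1 - u / 2) ≥ 1` on `[0, 1]`. -/
lemma exp_neg_le_one_sub_half {u : ℝ} (h0 : 0 ≤ u) (h1 : u ≤ 1) : Real.exp (-u) ≤ 1 - u / 2 := by
  have h2 : 1 + u ≤ Real.exp u := by linarith [Real.add_one_le_exp u]
  rw [Real.exp_neg]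
  refine (inv_anti₀ (by linarith) h2).trans ?_
  rw [inv_le_iff_one_le_mul₀ (by linarith)]
  nlinarith

/-- To replace the observed `Δ²` by its mean, the exponential is linearized and then restored: `E
exp(-Δ²/2) ≤ 1 - EΔ²/4 ≤ exp(-EΔ²/4)`. The first inequality needs `|Δ|` bounded and loses a factor
two against the empirical version. -/
lemma lintegral_exp_population_le {π : Policy S A H} (hπ : ∀ h, Measurable (π h)) (h : Fin H)
    {u : S × A → ℝ} (hu : Measurable u) {v : S → ℝ} (hv : Measurable v)
    (hv01 : ∀ s, v s ∈ Set.Icc (0 : ℝ) 1) (hgap : ∀ x, |M.gap h u v x| ≤ 1) :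
    ∫⁻ τ, ENNReal.ofReal (Real.exp ((∫ x, M.gap h u v x ^ 2 ∂(M.occ π h)) / 4 -
      M.excess h u v (τ h))) ∂(trajLaw H M.P π M.s₁) ≤ 1 := by
  have := isProbabilityMeasure_trajLaw (P := M.P) hπ M.s₁
  have hg := measurable_gap (M := M) (h := h) hu hv
  have hX := measurable_excess (M := M) (h := h) hu hv
  set E := ∫ x, M.gap h u v x ^ 2 ∂(M.occ π h) with hE
  have hsq : ∀ x, M.gap h u v x ^ 2 ≤ 1 := fun x => by
    rw [← sq_abs]; exact pow_le_one₀ (abs_nonneg _) (hgap x)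
  have hint : Integrable (fun τ : Traj S A H => M.gap h u v (τ h).1 ^ 2)
      (trajLaw H M.P π M.s₁) :=
    integrable_of_abs_le (B := 1)
      ((hg.comp (measurable_fst.comp (measurable_pi_apply h))).pow_const 2)
      fun τ => by rw [abs_of_nonneg (sq_nonneg _)]; exact hsq _
  have key : ∫⁻ τ, ENNReal.ofReal (Real.exp (-M.excess h u v (τ h))) ∂(trajLaw H M.P π M.s₁) ≤
      ENNReal.ofReal (Real.exp (-(E / 4))) := by
    rw [lintegral_trajLaw_step hπ M.s₁ h (g := fun y => ENNReal.ofReal (Real.exp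
      (-M.excess h u v y)))]
    · calc _ ≤ ∫⁻ τ, ENNReal.ofReal (1 - M.gap h u v (τ h).1 ^ 2 / 4) ∂(trajLaw H M.P π M.s₁) := by
            refine lintegral_mono fun τ => ?_
            refine (lintegral_exp_neg_excess_le h u hv hv01 (τ h).1).trans
              (ENNReal.ofReal_le_ofReal ?_)
            refine (exp_neg_le_one_sub_half (by positivity) ?_).trans (le_of_eq (by ring))
            linarith [hsq (τ h).1]
        _ = ENNReal.ofReal (∫ τ, (1 - M.gap h u v (τ h).1 ^ 2 / 4) ∂(trajLaw H M.P π M.s₁)) := by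
            rw [ofReal_integral_eq_lintegral_ofReal]
            · exact (integrable_const _).sub (hint.div_const 4)
            · exact Filter.Eventually.of_forall fun τ => by
                simp only [Pi.zero_apply]; linarith [hsq (τ h).1]
        _ ≤ _ := by
            refine ENNReal.ofReal_le_ofReal ?_
            rw [integral_sub (integrable_const _) (hint.div_const 4), integral_div,
              hE, integral_occ h (hg.pow_const 2)]
            simp only [integral_const, probReal_univ, smul_eq_mul, mul_one]
            linarith [Real.add_one_le_exp (-((∫ τ, M.gap h u v (τ h).1 ^ 2
              ∂(trajLaw H M.P π M.s₁)) / 4))]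
    · exact (Real.measurable_exp.comp hX.neg).ennreal_ofReal
  simp only [sub_eq_add_neg, Real.exp_add, ENNReal.ofReal_mul (Real.exp_nonneg _)]
  rw [lintegral_const_mul]
  · refine (mul_le_mul_right key _).trans ?_
    rw [← ENNReal.ofReal_mul (Real.exp_nonneg _), ← Real.exp_add]
    simp
  · exact (Real.measurable_exp.comp (hX.comp (measurable_pi_apply h)).neg).ennreal_ofReal

/-- Hoeffding's lemma on `[-1, 1]`. It will be applied to the residual of `f^t`, which is fixed
before episode `t` is played, so no net is needed. -/
lemma lintegral_exp_deviation_le {π : Policy S A H} (hπ : ∀ h, Measurable (π h)) (h : Fin H)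
    {φ : S × A → ℝ} (hφ : Measurable φ) (hφ1 : ∀ x, |φ x| ≤ 1) (l : ℝ) :
    ∫⁻ τ, ENNReal.ofReal (Real.exp (l * ((∫ x, φ x ∂(M.occ π h)) - φ (τ h).1) - l ^ 2 / 2))
      ∂(trajLaw H M.P π M.s₁) ≤ 1 := by
  have := isProbabilityMeasure_trajLaw (P := M.P) hπ M.s₁
  have hm : Measurable fun τ : Traj S A H => φ (τ h).1 :=
    hφ.comp (measurable_fst.comp (measurable_pi_apply h))
  have h1 := lintegral_exp_mul_sub_integral_le (μ := trajLaw H M.P π M.s₁) hm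
    (fun τ => Set.mem_Icc.2 (abs_le.1 (hφ1 (τ h).1))) (-l)
  rw [integral_occ h hφ]
  have h2 : ∀ τ : Traj S A H, Real.exp (l * ((∫ τ, φ (τ h).1 ∂(trajLaw H M.P π M.s₁)) -
      φ (τ h).1) - l ^ 2 / 2) = Real.exp (-(l ^ 2 / 2)) *
      Real.exp (-l * (φ (τ h).1 - ∫ τ, φ (τ h).1 ∂(trajLaw H M.P π M.s₁))) := by
    intro τ
    rw [← Real.exp_add]
    congr 1
    ring
  simp_rw [h2, ENNReal.ofReal_mul (Real.exp_nonneg _)]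
  rw [lintegral_const_mul]
  · refine (mul_le_mul_right h1 _).trans ?_
    rw [← ENNReal.ofReal_mul (Real.exp_nonneg _), ← Real.exp_add]
    refine ENNReal.ofReal_le_one.2 (Real.exp_le_one_iff.2 (le_of_eq ?_))
    ring
  · exact (Real.measurable_exp.comp ((hm.sub_const _).const_mul _)).ennreal_ofReal

end MDP

/-! ### Distributional Eluder dimension -/

section Eluder

/-- Online assignment to buckets: if the weights `w t i`, `i < t`, have total at most
`B < m * e`, then the indices can be put into `m` buckets such that each has total weight at most
`e` against its predecessors in its own bucket. -/
lemma exists_bucket_assignment {w : ℕ → ℕ → ℝ} (hw : ∀ t i, 0 ≤ w t i) {B e : ℝ} {m : ℕ}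
    (hm : 0 < m) (hB : B < m * e) (p : ℕ → Prop) [DecidablePred p] {k : ℕ}
    (hsum : ∀ t < k, ∑ i ∈ Finset.range t, w t i ≤ B) :
    ∃ c : ℕ → Fin m, ∀ t < k, ∑ i ∈ Finset.range t with p i ∧ c i = c t, w t i ≤ e := by
  induction k with
  | zero => exact ⟨fun _ => ⟨0, hm⟩, by simp⟩
  | succ k ih =>
    obtain ⟨c, hc⟩ := ih fun t ht => hsum t (by omega)
    -- Pigeonhole: if all `m` buckets were too heavy for the new index, their weights would add up
    -- to at least `m * e > B`.
    obtain ⟨j, hj⟩ : ∃ j : Fin m, ∑ i ∈ Finset.range k with p i ∧ c i = j, w k i ≤ e := by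
      by_contra! hcon
      have h1 : ∑ j : Fin m, ∑ i ∈ Finset.range k with p i ∧ c i = j, w k i ≤ B := by
        have h2 : ∀ j : Fin m, ∑ i ∈ Finset.range k with p i ∧ c i = j, w k i ≤
            ∑ i ∈ Finset.range k with c i = j, w k i := fun j =>
          Finset.sum_le_sum_of_subset_of_nonneg
            (fun i hi => by
              simp only [Finset.mem_filter] at hi ⊢
              exact ⟨hi.1, hi.2.2⟩) fun i _ _ => hw _ _
        refine (Finset.sum_le_sum fun j _ => h2 j).trans ?_
        rw [Finset.sum_fiberwise]
        exact hsum k (by omega)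
      have h3 : (m : ℝ) * e ≤ ∑ j : Fin m, ∑ i ∈ Finset.range k with p i ∧ c i = j, w k i := by
        have := Finset.sum_le_sum fun (j : Fin m) (_ : j ∈ Finset.univ) => (hcon j).le
        simpa using this
      linarith
    refine ⟨Function.update c k j, fun t ht => ?_⟩
    have hupd : ∀ i, i ≠ k → Function.update c k j i = c i := fun i hi => by simp [hi]
    have hcongr : ∀ t ≤ k, ∀ j', (Finset.range t).filter
        (fun i => p i ∧ Function.update c k j i = j') =
        (Finset.range t).filter (fun i => p i ∧ c i = j') := by
      intro t ht j'
      refine Finset.filter_congr fun i hi => ?_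
      rw [hupd i (by have := Finset.mem_range.1 hi; omega)]
    rw [hcongr t (by omega)]
    rcases Nat.lt_succ_iff_lt_or_eq.1 ht with h | h
    · rw [hupd t h.ne]
      exact hc t h
    · subst h
      simpa using hj

variable {X : Type*} [MeasurableSpace X]

/-- Enumerating `s` in increasing order gives an `ε'`-independent sequence. -/
lemma card_le_of_forall_isIndepOf {Φ : Set (X → ℝ)} {Ps : Set (Measure X)} {ε ε' : ℝ} {d : ℕ}
    (hd : deDim Φ Ps ε ≤ d) (hε : ε ≤ ε') (hε0 : 0 ≤ ε') {φ : ℕ → X → ℝ} {μ : ℕ → Measure X}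
    (s : Finset ℕ) (hφ : ∀ t ∈ s, φ t ∈ Φ) (hμ : ∀ t ∈ s, μ t ∈ Ps)
    (hlarge : ∀ t ∈ s, ε' < |∫ x, φ t x ∂(μ t)|)
    (hsmall : ∀ t ∈ s, ∑ i ∈ s with i < t, (∫ x, φ t x ∂(μ i)) ^ 2 ≤ ε' ^ 2) :
    s.card ≤ d := by
  have key : (s.card : ℕ∞) ≤ deDim Φ Ps ε := by
    set e := s.orderEmbOfFin rfl
    have he : ∀ i, e i ∈ s := fun i => s.orderEmbOfFin_mem rfl i
    refine le_iSup₂_of_le s.card ⟨fun i => μ (e i), fun i => hμ _ (he i), ε', hε, fun i => ?_⟩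
      le_rfl
    refine ⟨φ (e i), hφ _ (he i), ?_, hlarge _ (he i)⟩
    refine Real.sqrt_le_iff.2 ⟨hε0, le_trans ?_ (hsmall _ (he i))⟩
    have hinj : Function.Injective fun j : Fin i => e (Fin.castLE i.isLt.le j) :=
      e.injective.comp (Fin.castLE_injective _)
    rw [← Finset.sum_image (s := (Finset.univ : Finset (Fin i)))
      (g := fun j : Fin i => e (Fin.castLE i.isLt.le j))
      (f := fun t => (∫ x, φ (e i) x ∂(μ t)) ^ 2) (hinj.injOn)]
    refine Finset.sum_le_sum_of_subset_of_nonneg ?_ fun _ _ _ => sq_nonneg _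
    intro t ht
    obtain ⟨j, -, rfl⟩ := Finset.mem_image.1 ht
    refine Finset.mem_filter.2 ⟨he _, e.lt_iff_lt.2 ?_⟩
    exact Fin.lt_def.2 j.2
  exact_mod_cast key.trans hd

/-- The number of large deviations is controlled by the distributional Eluder dimension. -/
lemma card_large_le {Φ : Set (X → ℝ)} {Ps : Set (Measure X)} {ε : ℝ} {d : ℕ}
    (hd : deDim Φ Ps ε ≤ d) {φ : ℕ → X → ℝ} {μ : ℕ → Measure X} {k : ℕ}
    (hφ : ∀ t < k, φ t ∈ Φ) (hμ : ∀ t < k, μ t ∈ Ps) {B : ℝ} (hB0 : 0 ≤ B)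
    (hB : ∀ t < k, ∑ i ∈ Finset.range t, (∫ x, φ t x ∂(μ i)) ^ 2 ≤ B)
    {ε' : ℝ} (hε : ε ≤ ε') (hε0 : 0 < ε') :
    (((Finset.range k).filter fun t => ε' < |∫ x, φ t x ∂(μ t)|).card : ℝ) ≤
      (B / ε' ^ 2 + 1) * d := by
  classical
  -- The least number of buckets with `B < m * ε' ^ 2`.
  set m := ⌊B / ε' ^ 2⌋₊ + 1 with hm
  have hBm : B < m * ε' ^ 2 := by
    rw [← div_lt_iff₀ (by positivity)]
    rw [hm]; push_cast
    exact Nat.lt_floor_add_one (B / ε' ^ 2)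
  obtain ⟨c, hc⟩ := exists_bucket_assignment
    (w := fun t i => (∫ x, φ t x ∂(μ i)) ^ 2) (fun _ _ => sq_nonneg _) (m := m)
    (Nat.succ_pos _) hBm (fun t => ε' < |∫ x, φ t x ∂(μ t)|) hB
  set s := (Finset.range k).filter fun t => ε' < |∫ x, φ t x ∂(μ t)| with hs
  -- In a bucket each large deviation exceeds `ε'`, while the squares against its large predecessors
  -- there sum to at most `ε' ^ 2`.
  have hbucket : ∀ j : Fin m, (s.filter fun t => c t = j).card ≤ d := by
    intro j
    have hmem : ∀ t ∈ s.filter (fun t => c t = j),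
        t < k ∧ ε' < |∫ x, φ t x ∂(μ t)| ∧ c t = j := by
      intro t ht
      simp only [hs, Finset.mem_filter, Finset.mem_range] at ht
      exact ⟨ht.1.1, ht.1.2, ht.2⟩
    refine card_le_of_forall_isIndepOf hd hε hε0.le _ (fun t ht => hφ t (hmem t ht).1)
      (fun t ht => hμ t (hmem t ht).1) (fun t ht => (hmem t ht).2.1) fun t ht => ?_
    refine le_trans (Finset.sum_le_sum_of_subset_of_nonneg ?_ fun _ _ _ => sq_nonneg _)
      (hc t (hmem t ht).1)
    intro i hi
    obtain ⟨hi1, hi2⟩ := Finset.mem_filter.1 hi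
    refine Finset.mem_filter.2 ⟨Finset.mem_range.2 hi2, (hmem i hi1).2.1, ?_⟩
    rw [(hmem i hi1).2.2, (hmem t ht).2.2]
  have hcard : s.card ≤ m * d := by
    rw [Finset.card_eq_sum_card_fiberwise (f := c) (t := Finset.univ) fun _ _ => by simp]
    refine (Finset.sum_le_sum fun j _ => hbucket j).trans ?_
    simp
  calc (s.card : ℝ) ≤ m * d := by exact_mod_cast hcard
    _ ≤ (B / ε' ^ 2 + 1) * d := by
      gcongr
      rw [hm]; push_cast
      gcongr
      exact Nat.floor_le (by positivity)

/-- Layer-cake formula above the cutoff `x₀`: the integral is the length of `(x₀, a)`, and vanishes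
when `a ≤ x₀`. -/
lemma le_add_integral_indicator {a x₀ : ℝ} (ha : a ≤ 1) :
    a ≤ x₀ + ∫ x in Set.Ioc x₀ 1, (Set.Iio a).indicator (fun _ => (1 : ℝ)) x := by
  rw [integral_indicator measurableSet_Iio, setIntegral_const, smul_eq_mul, mul_one,
    Measure.real, Measure.restrict_apply measurableSet_Iio]
  have h1 : Set.Iio a ∩ Set.Ioc x₀ 1 = Set.Ioo x₀ a := by
    ext x
    simp only [Set.mem_inter_iff, Set.mem_Iio, Set.mem_Ioc, Set.mem_Ioo]
    constructor
    · rintro ⟨h1, h2, -⟩; exact ⟨h2, h1⟩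
    · rintro ⟨h1, h2⟩; exact ⟨h2, h1, by linarith⟩
  rw [h1, Real.volume_Ioo, ENNReal.toReal_ofReal']
  linarith [le_max_left (a - x₀) 0]

/-- From a bound on the number of large terms to a bound on the sum. -/
lemma sum_le_of_card_large_le {a : ℕ → ℝ} {k : ℕ}
    (h1 : ∀ t < k, a t ≤ 1) {ω B d : ℝ} (hω : 0 < ω) (hB : 0 ≤ B) (hd : 0 ≤ d)
    (hcard : ∀ ε, ω ≤ ε → (((Finset.range k).filter fun t => ε < a t).card : ℝ) ≤
      (B / ε ^ 2 + 1) * d) :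
    ∑ t ∈ Finset.range k, a t ≤ k * ω + 2 * √(d * B * k) + √(d * k) := by
  have hsum1 : ∑ t ∈ Finset.range k, a t ≤ k := by
    have := Finset.sum_le_sum fun t (ht : t ∈ Finset.range k) => h1 t (Finset.mem_range.1 ht)
    simpa using this
  -- For `k ≤ d` the trivial bound `k ≤ √(d * k)` suffices.
  rcases le_or_gt (k : ℝ) d with hkd | hkd
  · have : (k : ℝ) ≤ √(d * k) := Real.le_sqrt_of_sq_le (by nlinarith [Nat.cast_nonneg (α := ℝ) k])
    have : 0 ≤ k * ω := by positivity
    linarith [Real.sqrt_nonneg (d * B * k)]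
  have hk : (0 : ℝ) < k := lt_of_le_of_lt hd hkd
  have hdk : d ≤ √(d * k) := Real.le_sqrt_of_sq_le (by nlinarith)
  -- This cutoff balances the cost `k * y` of small terms against the tail integral `d * B / y`.
  -- Adding `ω` below keeps the cutoff in the range of `hcard`.
  set y := √(d * B / k) with hy
  have hy0 : 0 ≤ y := Real.sqrt_nonneg _
  have hyk : k * y = √(d * B * k) := by
    rw [hy, show d * B * k = k ^ 2 * (d * B / k) by field_simp, Real.sqrt_mul (by positivity),
      Real.sqrt_sq hk.le]
  set x₀ := ω + y with hx₀
  have hx₀0 : 0 < x₀ := by positivity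
  rcases le_or_gt 1 x₀ with hx | hx
  · have : (k : ℝ) ≤ k * x₀ := le_mul_of_one_le_right hk.le hx
    rw [hx₀, mul_add, hyk] at this
    linarith [Real.sqrt_nonneg (d * B * k), Real.sqrt_nonneg (d * k)]
  have hind : ∀ t, IntegrableOn ((Set.Iio (a t)).indicator fun _ => (1 : ℝ)) (Set.Ioc x₀ 1) :=
    fun t => (integrable_const (1 : ℝ)).indicator measurableSet_Iio
  have hcont : ContinuousOn (fun x : ℝ => d * B * x ^ (-2 : ℤ) + d) (Set.uIcc x₀ 1) := by
    refine ContinuousOn.add (ContinuousOn.mul continuousOn_const ?_) continuousOn_const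
    refine ContinuousOn.zpow₀ continuousOn_id _ fun x hx' => Or.inl ?_
    rw [Set.uIcc_of_le hx.le] at hx'
    exact (hx₀0.trans_le hx'.1).ne'
  have hzpow : ContinuousOn (fun x : ℝ => x ^ (-2 : ℤ)) (Set.uIcc x₀ 1) := by
    refine ContinuousOn.zpow₀ continuousOn_id _ fun x hx' => Or.inl ?_
    rw [Set.uIcc_of_le hx.le] at hx'
    exact (hx₀0.trans_le hx'.1).ne'
  have hint : ∫ x in Set.Ioc x₀ 1, (d * B * x ^ (-2 : ℤ) + d) ≤ d * B / x₀ + d := by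
    rw [← intervalIntegral.integral_of_le hx.le, intervalIntegral.integral_add
      ((hzpow.intervalIntegrable).const_mul _) (by simp), intervalIntegral.integral_const_mul,
      integral_zpow (Or.inr ⟨by norm_num, by
        rw [Set.uIcc_of_le hx.le]; exact fun h => absurd h.1 (not_le.2 hx₀0)⟩)]
    simp only [intervalIntegral.integral_const, smul_eq_mul]
    have e1 : ((1 : ℝ) ^ (-2 + 1 : ℤ) - x₀ ^ (-2 + 1 : ℤ)) / ((-2 : ℤ) + 1) = 1 / x₀ - 1 := by
      norm_num [zpow_neg, div_neg]
    rw [e1]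
    have : 0 ≤ d * B := by positivity
    rw [mul_sub, mul_one_div]
    nlinarith
  have hcount : ∀ x ∈ Set.Ioc x₀ 1, ∑ t ∈ Finset.range k, (Set.Iio (a t)).indicator
      (fun _ => (1 : ℝ)) x ≤ d * B * x ^ (-2 : ℤ) + d := by
    intro x hx'
    have e2 : ∑ t ∈ Finset.range k, (Set.Iio (a t)).indicator (fun _ => (1 : ℝ)) x =
        ((Finset.range k).filter fun t => x < a t).card := by
      simp [Set.indicator_apply]
    rw [e2]
    refine (hcard x (by linarith [hx'.1])).trans (le_of_eq ?_)
    rw [zpow_neg]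
    norm_cast
    field_simp
  have hmain : ∑ t ∈ Finset.range k, a t ≤ k * x₀ + (d * B / x₀ + d) := by
    calc ∑ t ∈ Finset.range k, a t
        ≤ ∑ t ∈ Finset.range k, (x₀ + ∫ x in Set.Ioc x₀ 1,
          (Set.Iio (a t)).indicator (fun _ => (1 : ℝ)) x) :=
          Finset.sum_le_sum fun t ht => le_add_integral_indicator (h1 t (Finset.mem_range.1 ht))
      _ = k * x₀ + ∫ x in Set.Ioc x₀ 1, ∑ t ∈ Finset.range k,
          (Set.Iio (a t)).indicator (fun _ => (1 : ℝ)) x := by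
          rw [Finset.sum_add_distrib, integral_finsetSum _ fun t _ => hind t]
          simp
      _ ≤ k * x₀ + ∫ x in Set.Ioc x₀ 1, (d * B * x ^ (-2 : ℤ) + d) := by
          gcongr 1
          refine setIntegral_mono_on (integrable_finsetSum _ fun t _ => hind t) ?_
            measurableSet_Ioc hcount
          exact (intervalIntegrable_iff_integrableOn_Ioc_of_le hx.le).1 hcont.intervalIntegrable
      _ ≤ _ := by gcongr
  have hlast : d * B / x₀ ≤ √(d * B * k) := by
    rw [div_le_iff₀ hx₀0, ← hyk]
    have : y ^ 2 * k = d * B := by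
      rw [hy, Real.sq_sqrt (by positivity)]; field_simp
    rw [← this, hx₀]
    have : 0 ≤ k * y * ω := by positivity
    nlinarith
  rw [hx₀, mul_add, hyk, ← hx₀] at hmain
  linarith

/-- The sum of the deviations is controlled by the distributional Eluder dimension. -/
lemma sum_abs_integral_le {Φ : Set (X → ℝ)} {Ps : Set (Measure X)} {ω : ℝ} (hω : 0 < ω) {d : ℕ}
    (hd : deDim Φ Ps ω ≤ d) {φ : ℕ → X → ℝ} {μ : ℕ → Measure X} {k : ℕ}
    (hφ : ∀ t < k, φ t ∈ Φ) (hμ : ∀ t < k, μ t ∈ Ps)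
    (hone : ∀ t < k, |∫ x, φ t x ∂(μ t)| ≤ 1) {B : ℝ} (hB0 : 0 ≤ B)
    (hB : ∀ t < k, ∑ i ∈ Finset.range t, (∫ x, φ t x ∂(μ i)) ^ 2 ≤ B) :
    ∑ t ∈ Finset.range k, |∫ x, φ t x ∂(μ t)| ≤
      k * ω + 2 * √(d * B * k) + √(d * k) :=
  sum_le_of_card_large_le hone hω hB0 d.cast_nonneg
    fun _ hε => card_large_le hd hφ hμ hB0 hB hε (hω.trans_le hε)

end Eluder

/-! ### Finite nets -/

section Nets

variable {S A : Type*} {H : ℕ}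

lemma abs_sub_le_of_edist_le {f g : QTuple S A H} {ε : ℝ≥0}
    (h : edist (fun i => UniformFun.ofFun (f i)) (fun i => UniformFun.ofFun (g i)) ≤ ε)
    (i : Fin H) (x : S × A) : |f i x - g i x| ≤ ε := by
  have h1 := UniformFun.edist_le.1 ((edist_le_pi_edist _ _ i).trans h) x
  simp only [UniformFun.toFun_ofFun, edist_dist] at h1
  rw [← Real.dist_eq]
  exact (ENNReal.ofReal_le_iff_le_toReal ENNReal.coe_ne_top).1 h1

lemma exists_finite_net {V : Set (QTuple S A H)} {ε : ℝ≥0} {N : ℕ} (hN : coverNum V ε = N) :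
    ∃ z : Fin N → QTuple S A H, ∀ f ∈ V, ∃ j, ∀ h x, |f h x - z j h x| ≤ ε := by
  have hne : coverNum V ε ≠ ⊤ := by rw [hN]; exact ENat.natCast_ne_top N
  obtain ⟨C, hCV, hfin, hcov, hcard⟩ := Metric.exists_set_encard_eq_coveringNumber hne
  have hcard' : hfin.toFinset.card = N := by
    rw [hfin.encard_eq_coe_toFinset_card] at hcard
    have := hcard.trans hN
    exact_mod_cast this
  let e := hfin.toFinset.equivFinOfCardEq hcard'
  have hmem : ∀ j, ((e.symm j : _) : Fin H → UniformFun (S × A) ℝ) ∈ C := fun j =>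
    hfin.mem_toFinset.1 (e.symm j).2
  choose z hzV hz using fun j => hCV (hmem j)
  refine ⟨z, fun f hf => ?_⟩
  obtain ⟨w, hw, hfw⟩ := hcov (Set.mem_image_of_mem _ hf)
  refine ⟨e ⟨w, hfin.mem_toFinset.2 hw⟩, abs_sub_le_of_edist_le ?_⟩
  have hzw := hz (e ⟨w, hfin.mem_toFinset.2 hw⟩)
  simp only [Equiv.symm_apply_apply] at hzw
  rw [hzw]
  exact hfw

/-- A net of a class yields a net, with centres inside, of a subclass. -/
lemma exists_net_of_subset {V W : Set (QTuple S A H)} (hWV : W ⊆ V) (hW : W.Nonempty) {ε : ℝ≥0}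
    {N : ℕ} (hN : coverNum V ε = N) :
    ∃ z : Fin N → QTuple S A H, (∀ j, z j ∈ W) ∧
      ∀ f ∈ W, ∃ j, ∀ h x, |f h x - z j h x| ≤ 2 * ε := by
  classical
  obtain ⟨z, hz⟩ := exists_finite_net hN
  obtain ⟨f₀, hf₀⟩ := hW
  -- Each ball that meets `W` is recentred at one of its points in `W`, which doubles the radius;
  -- the other balls get the dummy centre `f₀`. Centres in the class inherit its measurability,
  -- bounds and greedy policies.
  let good (j : Fin N) (g : QTuple S A H) : Prop := g ∈ W ∧ ∀ h x, |g h x - z j h x| ≤ ε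
  refine ⟨fun j => if hj : ∃ g, good j g then hj.choose else f₀, fun j => ?_, fun f hf => ?_⟩
  · by_cases hj : ∃ g, good j g
    · simpa only [hj, dif_pos] using hj.choose_spec.1
    · simpa only [hj, dif_neg, not_false_eq_true] using hf₀
  · obtain ⟨j, hj⟩ := hz f (hWV hf)
    refine ⟨j, fun h x => ?_⟩
    have hex : ∃ g, good j g := ⟨f, hf, hj⟩
    have h1 := hex.choose_spec.2 h x
    simp only [hex, dif_pos]
    have h2 := abs_sub_le (f h x) (z j h x) (hex.choose h x)
    rw [abs_sub_comm] at h1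
    linarith [hj h x]

lemma coverNum_pos {V : Set (QTuple S A H)} (hV : V.Nonempty) {ε : ℝ≥0} {N : ℕ}
    (hN : coverNum V ε = N) : 1 ≤ N := by
  obtain ⟨z, hz⟩ := exists_finite_net hN
  obtain ⟨f, hf⟩ := hV
  obtain ⟨j, -⟩ := hz f hf
  exact j.pos

end Nets

/-! ### Consequences of the concentration bounds for the confidence sets -/

section Deterministic

variable {S A : Type*} [MeasurableSpace S] [MeasurableSpace A] {H : ℕ}

/-- The standing assumptions on the function classes. -/
structure Assumptions (M : MDP S A H) (F G : Fin H → Set (S × A → ℝ))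
    (greedy : QTuple S A H → Policy S A H) : Prop where
  memF : ∀ h, ∀ f ∈ F h, Measurable f ∧ ∀ x, f x ∈ Set.Icc (0 : ℝ) 1
  memG : ∀ h, ∀ g ∈ G h, Measurable g ∧ ∀ x, g x ∈ Set.Icc (0 : ℝ) 1
  greedy : IsGreedy F greedy
  realizable : M.Realizable F
  complete : M.Complete F G

namespace Assumptions

variable {M : MDP S A H} {F G : Fin H → Set (S × A → ℝ)} {greedy : QTuple S A H → Policy S A H}

lemma Qstar_mem (hM : Assumptions M F G greedy) : M.Qstar ∈ prodClass F :=
  fun h _ => hM.realizable h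

lemma r_le_one (hM : Assumptions M F G greedy) (h : Fin H) (x : S × A) : M.r h x ≤ 1 :=
  MDP.r_le_one (hM.greedy.measurable _ hM.Qstar_mem)
    (fun h x => ((hM.memF h _ (hM.realizable h)).2 x).2) h x

lemma bellman_mem (hM : Assumptions M F G greedy) {f : QTuple S A H} (hf : f ∈ prodClass F)
    (h : Fin H) : M.bellman h (entry f (h + 1)) ∈ G h :=
  hM.complete h ⟨_, entry_mem_classAt hf _, rfl⟩

lemma bellman_Qstar (hM : Assumptions M F G greedy) (h : Fin H) :
    M.bellman h (entry M.Qstar (h + 1)) = M.Qstar h :=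
  MDP.bellman_Qstar hM.r_le_one (hM.greedy.measurable _ hM.Qstar_mem)
    (hM.greedy.isMax _ hM.Qstar_mem) h

/-- Completeness applies because `Q^⋆` is a Bellman fixed point. -/
lemma Qstar_mem_G (hM : Assumptions M F G greedy) : M.Qstar ∈ prodClass G := fun h _ => by
  rw [← hM.bellman_Qstar h]
  exact hM.bellman_mem hM.Qstar_mem h

lemma measurable_of_mem (hM : Assumptions M F G greedy) {f : QTuple S A H}
    (hf : f ∈ prodClass F) (h : Fin H) : Measurable (f h) := (hM.memF h _ (hf h trivial)).1

lemma mem_Icc_of_mem (hM : Assumptions M F G greedy) {f : QTuple S A H}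
    (hf : f ∈ prodClass F) (h : Fin H) (x : S × A) : f h x ∈ Set.Icc (0 : ℝ) 1 :=
  (hM.memF h _ (hf h trivial)).2 x

lemma measurable_maxVal (hM : Assumptions M F G greedy) {f : QTuple S A H}
    (hf : f ∈ prodClass F) (j : ℕ) : Measurable (maxVal (entry f j)) :=
  MDP.measurable_maxVal_entry (hM.measurable_of_mem hf) (hM.greedy.measurable f hf)
    (hM.greedy.isMax f hf) j

lemma maxVal_mem_Icc (hM : Assumptions M F G greedy) {f : QTuple S A H}
    (hf : f ∈ prodClass F) (j : ℕ) (s : S) : maxVal (entry f j) s ∈ Set.Icc (0 : ℝ) 1 :=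
  MDP.maxVal_entry_mem_Icc (hM.mem_Icc_of_mem hf) (hM.greedy.isMax f hf) j s

lemma measurable_resid (hM : Assumptions M F G greedy) {f : QTuple S A H}
    (hf : f ∈ prodClass F) (h : Fin H) : Measurable (M.resid f h) :=
  (hM.measurable_of_mem hf h).sub (MDP.measurable_bellman (hM.measurable_maxVal hf _))

/-- Completeness places the regression target in `G h`, hence in `[0, 1]`. -/
lemma abs_gap_le_one (hM : Assumptions M F G greedy) {f : QTuple S A H}
    (hf : f ∈ prodClass F) (h : Fin H) {u : S × A → ℝ} (hu : ∀ x, u x ∈ Set.Icc (0 : ℝ) 1)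
    (x : S × A) : |M.gap h u (maxVal (entry f (h + 1))) x| ≤ 1 := by
  have h1 := hu x
  have h2 : M.target h (maxVal (entry f (h + 1))) x ∈ Set.Icc (0 : ℝ) 1 :=
    (hM.memG h _ (hM.bellman_mem hf h)).2 x
  rw [MDP.gap, abs_le]
  exact ⟨by linarith [h1.1, h2.2], by linarith [h1.2, h2.1]⟩

lemma abs_resid_le_one (hM : Assumptions M F G greedy) {f : QTuple S A H}
    (hf : f ∈ prodClass F) (h : Fin H) (x : S × A) : |M.resid f h x| ≤ 1 :=
  hM.abs_gap_le_one hf h (hM.mem_Icc_of_mem hf h) x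

lemma abs_maxVal_sub_le (hM : Assumptions M F G greedy) {f g : QTuple S A H}
    (hf : f ∈ prodClass F) (hg : g ∈ prodClass F) {ε : ℝ} (hε0 : 0 ≤ ε)
    (hε : ∀ h x, |f h x - g h x| ≤ ε) (j : ℕ) (s : S) :
    |maxVal (entry f j) s - maxVal (entry g j) s| ≤ ε := by
  by_cases hj : j < H
  · have h1 := hM.greedy.isMax f hf ⟨j, hj⟩ s
    have h2 := hM.greedy.isMax g hg ⟨j, hj⟩ s
    rw [entry_of_lt _ hj, entry_of_lt _ hj, maxVal_eq_of_le h1, maxVal_eq_of_le h2, abs_le]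
    have h3 := abs_le.1 (hε ⟨j, hj⟩ (s, greedy f ⟨j, hj⟩ s))
    have h4 := abs_le.1 (hε ⟨j, hj⟩ (s, greedy g ⟨j, hj⟩ s))
    constructor
    · linarith [h4.1, h1 (greedy g ⟨j, hj⟩ s)]
    · linarith [h3.2, h2 (greedy f ⟨j, hj⟩ s)]
  · rw [entry_of_not_lt _ hj, entry_of_not_lt _ hj, sub_self, abs_zero]
    exact hε0

lemma abs_integral_maxVal_sub_le (hM : Assumptions M F G greedy) {f g : QTuple S A H}
    (hf : f ∈ prodClass F) (hg : g ∈ prodClass F) {ε : ℝ} (hε0 : 0 ≤ ε)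
    (hε : ∀ h x, |f h x - g h x| ≤ ε) (j : ℕ) (μ : Measure S) [IsProbabilityMeasure μ] :
    |(∫ s, maxVal (entry f j) s ∂μ) - ∫ s, maxVal (entry g j) s ∂μ| ≤ ε := by
  have hint : ∀ f ∈ prodClass F, Integrable (maxVal (entry f j)) μ := fun f hf =>
    integrable_of_abs_le (B := 1) (hM.measurable_maxVal hf j) fun s => by
      have := hM.maxVal_mem_Icc hf j s
      rw [abs_of_nonneg this.1]; exact this.2
  rw [← integral_sub (hint f hf) (hint g hg)]
  exact abs_integral_le_of_abs_le (hM.abs_maxVal_sub_le hf hg hε0 hε j)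

lemma abs_resid_sub_le (hM : Assumptions M F G greedy) {f g : QTuple S A H}
    (hf : f ∈ prodClass F) (hg : g ∈ prodClass F) {ε : ℝ} (hε0 : 0 ≤ ε)
    (hε : ∀ h x, |f h x - g h x| ≤ ε) (h : Fin H) (x : S × A) :
    |M.resid f h x - M.resid g h x| ≤ 2 * ε := by
  have h1 := abs_le.1 (hε h x)
  have h2 := abs_le.1 (hM.abs_integral_maxVal_sub_le hf hg hε0 hε (h + 1) (M.P h x))
  rw [MDP.resid, MDP.resid, MDP.bellman_eq, MDP.bellman_eq, abs_le]
  constructor <;> linarith [h1.1, h1.2, h2.1, h2.2]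

end Assumptions

lemma sq_le_sq_add_of_abs_sub_le {a b e : ℝ} (ha : |a| ≤ 1) (hb : |b| ≤ 1) (hab : |a - b| ≤ e) :
    a ^ 2 ≤ b ^ 2 + 2 * e := by
  have h1 : a ^ 2 - b ^ 2 ≤ |a - b| * |a + b| := by
    rw [← abs_mul]
    exact (le_of_eq (by ring)).trans (le_abs_self _)
  have h2 : |a + b| ≤ 2 := (abs_add_le a b).trans (by linarith)
  have h3 : |a - b| * |a + b| ≤ e * 2 :=
    mul_le_mul hab h2 (abs_nonneg _) ((abs_nonneg _).trans hab)
  linarith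

lemma mul_le_mul_add_of_abs_sub_le {a b x y e : ℝ} (hb : |b| ≤ 1) (hx : |x| ≤ 1)
    (hab : |a - b| ≤ e) (hxy : |x - y| ≤ e) : a * x ≤ b * y + 2 * e := by
  have h1 : (a - b) * x ≤ e := by
    refine (le_abs_self _).trans ?_
    rw [abs_mul]
    nlinarith [abs_nonneg (a - b), abs_nonneg x]
  have h2 : b * (x - y) ≤ e := by
    refine (le_abs_self _).trans ?_
    rw [abs_mul]
    nlinarith [abs_nonneg (x - y), abs_nonneg b]
  linarith

namespace Assumptions

variable {M : MDP S A H} {F G : Fin H → Set (S × A → ℝ)} {greedy : QTuple S A H → Policy S A H}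

/-- Write the excess as `Δ² + 2Δξ`. Both `Δ` and `ξ` are bounded by one and move by at most `2ε`, so
`Δ²` and `Δξ` each move by at most `4ε`; the total is `4ε + 2 * 4ε`. -/
lemma excess_le_add (hM : Assumptions M F G greedy) {f g : QTuple S A H}
    (hf : f ∈ prodClass F) (hg : g ∈ prodClass F) {ε : ℝ} (hε0 : 0 ≤ ε)
    (hε : ∀ h x, |f h x - g h x| ≤ ε) (h : Fin H) (y : (S × A) × S) :
    M.excess h (f h) (maxVal (entry f (h + 1))) y ≤
      M.excess h (g h) (maxVal (entry g (h + 1))) y + 12 * ε := by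
  have hnoise : ∀ f ∈ prodClass F, |(∫ s', maxVal (entry f (h + 1)) s' ∂(M.P h y.1)) -
      maxVal (entry f (h + 1)) y.2| ≤ 1 := by
    intro f hf
    have h1 := hM.maxVal_mem_Icc hf (h + 1)
    have h2 : |∫ s', maxVal (entry f (h + 1)) s' ∂(M.P h y.1)| ≤ 1 :=
      abs_integral_le_of_abs_le fun s => by
        rw [abs_of_nonneg (h1 s).1]; exact (h1 s).2
    have h3 : 0 ≤ ∫ s', maxVal (entry f (h + 1)) s' ∂(M.P h y.1) :=
      integral_nonneg fun s => (h1 s).1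
    rw [abs_le] at h2 ⊢
    exact ⟨by linarith [(h1 y.2).2], by linarith [(h1 y.2).1, h2.2]⟩
  have hΔ : |M.gap h (f h) (maxVal (entry f (h + 1))) y.1 -
      M.gap h (g h) (maxVal (entry g (h + 1))) y.1| ≤ 2 * ε :=
    hM.abs_resid_sub_le hf hg hε0 hε h y.1
  have hΔf := hM.abs_gap_le_one hf h (hM.mem_Icc_of_mem hf h) y.1
  have hΔg := hM.abs_gap_le_one hg h (hM.mem_Icc_of_mem hg h) y.1
  have hξ : |((∫ s', maxVal (entry f (h + 1)) s' ∂(M.P h y.1)) - maxVal (entry f (h + 1)) y.2) -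
      ((∫ s', maxVal (entry g (h + 1)) s' ∂(M.P h y.1)) - maxVal (entry g (h + 1)) y.2)| ≤
      2 * ε := by
    have h1 := abs_le.1 (hM.abs_integral_maxVal_sub_le hf hg hε0 hε (h + 1) (M.P h y.1))
    have h2 := abs_le.1 (hM.abs_maxVal_sub_le hf hg hε0 hε (h + 1) y.2)
    rw [abs_le]
    constructor <;> linarith [h1.1, h1.2, h2.1, h2.2]
  rw [MDP.excess_eq, MDP.excess_eq]
  have e1 := sq_le_sq_add_of_abs_sub_le hΔf hΔg hΔ
  have e2 := mul_le_mul_add_of_abs_sub_le hΔg (hnoise f hf) hΔ hξ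
  linarith

/-- The losses of `u` and of its regression target differ by the sum of the excesses. -/
lemma _root_.Golf.MDP.loss_sub_loss {n : ℕ} (D : Fin n → Traj S A H) (h : Fin H)
    (u ζ : S × A → ℝ) :
    M.loss D h u ζ - M.loss D h (M.bellman h ζ) ζ = ∑ t, M.excess h u (maxVal ζ) (D t h) := by
  rw [MDP.loss, MDP.loss, ← Finset.sum_sub_distrib]
  rfl

lemma bddBelow_loss {n : ℕ} (D : Fin n → Traj S A H) (h : Fin H)
    (ζ : S × A → ℝ) : BddBelow (Set.range fun g : G h => M.loss D h g.1 ζ) :=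
  ⟨0, by rintro _ ⟨g, rfl⟩; exact Finset.sum_nonneg fun _ _ => sq_nonneg _⟩

/-- On the good event, the optimal `Q`-function belongs to the confidence set. -/
lemma Qstar_mem_confSet (hM : Assumptions M F G greedy) {n K N : ℕ} (hn : n ≤ K) (hK : 0 < K)
    (D : Fin n → Traj S A H) {z : Fin N → QTuple S A H} (hz : ∀ j, z j ∈ prodClass G)
    (hnet : ∀ g ∈ prodClass G, ∃ j, ∀ h x, |g h x - z j h x| ≤ 2 * (1 / K)) {L β : ℝ}
    (hgood : ∀ h j, ∑ t, (M.gap h (z j h) (maxVal (entry M.Qstar (h + 1))) (D t h).1 ^ 2 / 2 -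
      M.excess h (z j h) (maxVal (entry M.Qstar (h + 1))) (D t h)) < L) (hβ : L + 8 ≤ β) :
    M.Qstar ∈ M.confSet F G β D := by
  classical
  refine ⟨hM.Qstar_mem, fun h => ?_⟩
  have hne : Nonempty (G h) := ⟨⟨_, hM.bellman_mem hM.Qstar_mem h⟩⟩
  rw [← sub_le_iff_le_add]
  refine le_ciInf fun g => ?_
  -- The net consists of tuples, so the competitor `g` is completed to a tuple by the entries of
  -- `Q^⋆`, which lie in `G`.
  have hupd : Function.update M.Qstar h g.1 ∈ prodClass G := by
    intro i _
    by_cases hi : i = h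
    · subst hi; simp
    · simpa [hi] using hM.Qstar_mem_G i trivial
  obtain ⟨j, hj⟩ := hnet _ hupd
  have hj' : ∀ x, |g.1 x - z j h x| ≤ 2 * (1 / K) := fun x => by simpa using hj h x
  have hloss := M.loss_sub_loss D h g.1 (entry M.Qstar (h + 1))
  rw [hM.bellman_Qstar] at hloss
  have hdisc : ∀ t, M.excess h (z j h) (maxVal (entry M.Qstar (h + 1))) (D t h) ≤
      M.excess h g.1 (maxVal (entry M.Qstar (h + 1))) (D t h) + 8 * (1 / K) := by
    intro t
    have h1 := (hM.memG h _ g.2).2 (D t h).1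
    have h2 := (hM.memG h _ (hz j h trivial)).2 (D t h).1
    have h3 := hM.maxVal_mem_Icc hM.Qstar_mem (h + 1) (D t h).2
    have h4 := hM.r_le_one h (D t h).1
    have h5 := M.r_nonneg h (D t h).1
    have h6 := abs_le.1 (hj' (D t h).1)
    have h7 : (0 : ℝ) ≤ 1 / K := by positivity
    simp only [MDP.excess]
    set u := g.1 (D t h).1
    set w := z j h (D t h).1
    set b := M.r h (D t h).1 + maxVal (entry M.Qstar (h + 1)) (D t h).2
    -- Here `w + u ∈ [0, 2]` and `2 * b ∈ [0, 4]`. With net radius `2 / K` each sample costs at most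
    -- `8 / K`.
    have h8 : |w + u - 2 * b| ≤ 4 := by
      rw [abs_le]
      constructor <;> linarith [h1.1, h1.2, h2.1, h2.2, h3.1, h3.2]
    have h9 : (w - u) * (w + u - 2 * b) ≤ 2 * (1 / K) * 4 := by
      refine (le_abs_self _).trans ?_
      rw [abs_mul]
      exact mul_le_mul (by rw [abs_sub_comm]; exact hj' _) h8 (abs_nonneg _) (by positivity)
    have h10 : (w - b) ^ 2 - (u - b) ^ 2 = (w - u) * (w + u - 2 * b) := by ring
    have e1 : w - M.r h (D t h).1 - maxVal (entry M.Qstar (h + 1)) (D t h).2 = w - b := by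
      simp only [b]; ring
    have e2 : u - M.r h (D t h).1 - maxVal (entry M.Qstar (h + 1)) (D t h).2 = u - b := by
      simp only [b]; ring
    rw [e1, e2]
    linarith
  have hsum := Finset.sum_le_sum fun t (_ : t ∈ Finset.univ) => hdisc t
  rw [Finset.sum_add_distrib, Finset.sum_const, Finset.card_univ, Fintype.card_fin,
    nsmul_eq_mul] at hsum
  have hnK : (n : ℝ) * (8 * (1 / K)) ≤ 8 := by
    have : (n : ℝ) / K ≤ 1 := (div_le_one (by exact_mod_cast hK)).2 (by exact_mod_cast hn)
    calc (n : ℝ) * (8 * (1 / K)) = 8 * (n / K) := by ring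
      _ ≤ 8 := by linarith
  have hg := hgood h j
  rw [Finset.sum_sub_distrib] at hg
  -- The squared gaps can be dropped, so the net point beats `Q^⋆` by less than `L` in loss, and `g`
  -- by less than `L + 8`.
  have hpos : 0 ≤ ∑ t, M.gap h (z j h) (maxVal (entry M.Qstar (h + 1))) (D t h).1 ^ 2 / 2 :=
    Finset.sum_nonneg fun _ _ => by positivity
  linarith

/-- By completeness the regression target of `f` is itself a competitor in the infimum over `G h`.
-/
lemma sum_excess_le_of_mem_confSet (hM : Assumptions M F G greedy) {n : ℕ}
    {D : Fin n → Traj S A H} {f : QTuple S A H} {β : ℝ} (hf : f ∈ M.confSet F G β D) (h : Fin H) :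
    ∑ t, M.excess h (f h) (maxVal (entry f (h + 1))) (D t h) ≤ β := by
  rw [← MDP.loss_sub_loss]
  have h1 := hf.2 h
  have h2 := ciInf_le (bddBelow_loss (M := M) (G := G) D h (entry f (h + 1)))
    ⟨_, hM.bellman_mem hf.1 h⟩
  simp only at h2
  linarith

/-- On the good event, the members of the confidence set have small residuals on the data. -/
lemma sum_sq_resid_le (hM : Assumptions M F G greedy) {n K : ℕ} (hn : n ≤ K) (hK : 0 < K)
    {D : Fin n → Traj S A H} {f z : QTuple S A H} {β : ℝ} (hf : f ∈ M.confSet F G β D)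
    (hz : z ∈ prodClass F) (hfz : ∀ h x, |f h x - z h x| ≤ 2 * (1 / K)) {L : ℝ} (h : Fin H)
    (hgood : ∑ t, (M.gap h (z h) (maxVal (entry z (h + 1))) (D t h).1 ^ 2 / 2 -
      M.excess h (z h) (maxVal (entry z (h + 1))) (D t h)) < L) :
    ∑ t, M.resid f h (D t h).1 ^ 2 ≤ 2 * (β + 24 + L) + 8 := by
  have hε0 : (0 : ℝ) ≤ 2 * (1 / K) := by positivity
  have hzf : ∀ h x, |z h x - f h x| ≤ 2 * (1 / K) := fun h x => by
    rw [abs_sub_comm]; exact hfz h x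
  have h1 := sum_excess_le_of_mem_confSet hM hf h
  have h2 := Finset.sum_le_sum fun t (_ : t ∈ Finset.univ) =>
    hM.excess_le_add hz hf.1 hε0 hzf h (D t h)
  have h3 := Finset.sum_le_sum fun t (_ : t ∈ Finset.univ) =>
    sq_le_sq_add_of_abs_sub_le (hM.abs_resid_le_one hf.1 h (D t h).1)
      (hM.abs_resid_le_one hz h (D t h).1) (hM.abs_resid_sub_le hf.1 hz hε0 hfz h (D t h).1)
  rw [Finset.sum_add_distrib, Finset.sum_const, Finset.card_univ, Fintype.card_fin,
    nsmul_eq_mul] at h2 h3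
  rw [Finset.sum_sub_distrib, ← Finset.sum_div] at hgood
  have hnK : (n : ℝ) / K ≤ 1 := (div_le_one (by exact_mod_cast hK)).2 (by exact_mod_cast hn)
  -- At net radius `2 / K`, at most `K` samples cost in total `24` in the excess and `8` in the
  -- squared residuals.
  have e1 : (n : ℝ) * (12 * (2 * (1 / K))) = 24 * (n / K) := by ring
  have e2 : (n : ℝ) * (2 * (2 * (2 * (1 / K)))) = 8 * (n / K) := by ring
  have e3 : ∑ t, M.gap h (z h) (maxVal (entry z (h + 1))) (D t h).1 ^ 2 =
    ∑ t, M.resid z h (D t h).1 ^ 2 := rfl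
  rw [e1] at h2
  rw [e2] at h3
  rw [e3] at hgood
  linarith

/-- On the good event, the members of the confidence set have small expected residuals under the
previous policies. -/
lemma sum_integral_sq_resid_le (hM : Assumptions M F G greedy) {n K : ℕ} (hn : n ≤ K)
    (hK : 0 < K) {D : Fin n → Traj S A H} {f z : QTuple S A H} {β : ℝ}
    (hf : f ∈ M.confSet F G β D)
    (hz : z ∈ prodClass F) (hfz : ∀ h x, |f h x - z h x| ≤ 2 * (1 / K)) {L : ℝ} (h : Fin H)
    {ν : Fin n → Measure (S × A)} (hν : ∀ t, IsProbabilityMeasure (ν t))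
    (hgood : ∑ t, ((∫ x, M.gap h (z h) (maxVal (entry z (h + 1))) x ^ 2 ∂(ν t)) / 4 -
      M.excess h (z h) (maxVal (entry z (h + 1))) (D t h)) < L) :
    ∑ t, ∫ x, M.resid f h x ^ 2 ∂(ν t) ≤ 4 * (β + 24 + L) + 8 := by
  have hε0 : (0 : ℝ) ≤ 2 * (1 / K) := by positivity
  have hzf : ∀ h x, |z h x - f h x| ≤ 2 * (1 / K) := fun h x => by
    rw [abs_sub_comm]; exact hfz h x
  have h1 := sum_excess_le_of_mem_confSet hM hf h
  have h2 := Finset.sum_le_sum fun t (_ : t ∈ Finset.univ) =>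
    hM.excess_le_add hz hf.1 hε0 hzf h (D t h)
  have hint : ∀ f ∈ prodClass F, ∀ t, Integrable (fun x => M.resid f h x ^ 2) (ν t) :=
    fun f hf t => integrable_of_abs_le (B := 1) ((hM.measurable_resid hf h).pow_const 2)
      fun x => by
        rw [abs_pow]; exact pow_le_one₀ (abs_nonneg _) (hM.abs_resid_le_one hf h x)
  have h3 : ∀ t, ∫ x, M.resid f h x ^ 2 ∂(ν t) ≤
      (∫ x, M.resid z h x ^ 2 ∂(ν t)) + 2 * (2 * (2 * (1 / K))) := by
    intro t
    have := integral_mono (hint f hf.1 t) ((hint z hz t).add (integrable_const _)) fun x =>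
      sq_le_sq_add_of_abs_sub_le (hM.abs_resid_le_one hf.1 h x)
        (hM.abs_resid_le_one hz h x) (hM.abs_resid_sub_le hf.1 hz hε0 hfz h x)
    rw [integral_add' (hint z hz t) (integrable_const _)] at this
    simpa using this
  have h3 := Finset.sum_le_sum fun t (_ : t ∈ Finset.univ) => h3 t
  rw [Finset.sum_add_distrib, Finset.sum_const, Finset.card_univ, Fintype.card_fin,
    nsmul_eq_mul] at h2 h3
  rw [Finset.sum_sub_distrib, ← Finset.sum_div] at hgood
  have hnK : (n : ℝ) / K ≤ 1 := (div_le_one (by exact_mod_cast hK)).2 (by exact_mod_cast hn)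
  have e1 : (n : ℝ) * (12 * (2 * (1 / K))) = 24 * (n / K) := by ring
  have e2 : (n : ℝ) * (2 * (2 * (2 * (1 / K)))) = 8 * (n / K) := by ring
  have e3 : ∑ t, ∫ x, M.gap h (z h) (maxVal (entry z (h + 1))) x ^ 2 ∂(ν t) =
    ∑ t, ∫ x, M.resid z h x ^ 2 ∂(ν t) := rfl
  rw [e1] at h2
  rw [e2] at h3
  rw [e3] at hgood
  linarith

end Assumptions

end Deterministic

/-! ### Union bound and deterministic regret bound -/

section Regret

variable {S A : Type*} [MeasurableSpace S] [MeasurableSpace A] {H : ℕ}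

lemma sq_integral_le_integral_sq {X : Type*} [MeasurableSpace X] {μ : Measure X}
    [IsProbabilityMeasure μ] {φ : X → ℝ} (hφ : Measurable φ) {B : ℝ} (hB : ∀ x, |φ x| ≤ B) :
    (∫ x, φ x ∂μ) ^ 2 ≤ ∫ x, φ x ^ 2 ∂μ := by
  set m := ∫ x, φ x ∂μ with hm
  have h1 : Integrable φ μ := integrable_of_abs_le hφ hB
  have h2 : Integrable (fun x => φ x ^ 2) μ :=
    integrable_of_abs_le (B := B ^ 2) (hφ.pow_const 2) fun x => by
      rw [abs_pow]; exact pow_le_pow_left₀ (abs_nonneg _) (hB x) 2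
  have h3 : 0 ≤ ∫ x, (φ x ^ 2 - 2 * m * φ x + m ^ 2) ∂μ :=
    integral_nonneg fun x => by
      have : φ x ^ 2 - 2 * m * φ x + m ^ 2 = (φ x - m) ^ 2 := by ring
      simp only [this, Pi.zero_apply]
      positivity
  have h4 : Integrable (fun x => φ x ^ 2 - 2 * m * φ x) μ := h2.sub (h1.const_mul _)
  rw [integral_add h4 (integrable_const _),
    integral_sub h2 (h1.const_mul _), integral_const_mul, ← hm] at h3
  simp at h3
  nlinarith

namespace MDP

variable {M : MDP S A H} {pol : (t : ℕ) → (Fin t → Traj S A H) → Policy S A H}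

/-- A union bound for exponential supermartingales. -/
lemma runLaw_forall_cumSum_lt {K : ℕ} (hpol : MeasurablePol pol K) {ι : Type*} [Fintype ι]
    {ψ : ι → (t : ℕ) → (Fin t → Traj S A H) → Traj S A H → ℝ}
    (hψ : ∀ i, ∀ t < K, Measurable fun p : (Fin t → Traj S A H) × Traj S A H => ψ i t p.1 p.2)
    (hle : ∀ i, ∀ t < K, ∀ D, ∫⁻ τ, ENNReal.ofReal (Real.exp (ψ i t D τ))
      ∂(trajLaw H M.P (pol t D) M.s₁) ≤ 1) {n : ι → ℕ} (hn : ∀ i, n i ≤ K) (L : ℝ) :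
    ENNReal.ofReal (1 - Fintype.card ι * Real.exp (-L)) ≤
      M.runLaw pol K {D | ∀ i, cumSum (ψ i) (pre D (n i) (hn i)) < L} := by
  have := isProbabilityMeasure_runLaw (M := M) hpol le_rfl
  set E := {D : Fin K → Traj S A H | ∀ i, cumSum (ψ i) (pre D (n i) (hn i)) < L}
  have hcompl : M.runLaw pol K Eᶜ ≤ ENNReal.ofReal (Fintype.card ι * Real.exp (-L)) := by
    have hsub : Eᶜ ⊆ ⋃ i, {D | L ≤ cumSum (ψ i) (pre D (n i) (hn i))} := by
      intro D hD
      simp only [E, Set.mem_compl_iff, Set.mem_ofPred_eq, not_forall, not_lt] at hD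
      exact Set.mem_iUnion.2 hD
    refine (measure_mono hsub).trans ((measure_iUnion_fintype_le _ _).trans ?_)
    refine (Finset.sum_le_sum fun i _ =>
      runLaw_cumSum_ge_le hpol (hψ i) (hle i) (hn i) L).trans (le_of_eq ?_)
    rw [Finset.sum_const, Finset.card_univ, nsmul_eq_mul,
      ENNReal.ofReal_mul (Nat.cast_nonneg _), ENNReal.ofReal_natCast]
  rw [ENNReal.ofReal_sub _ (by positivity), ENNReal.ofReal_one]
  refine tsub_le_iff_right.2 ?_
  -- Subadditivity alone is used, so `E` need not be shown measurable.
  calc (1 : ℝ≥0∞) = M.runLaw pol K Set.univ := measure_univ.symm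
    _ = M.runLaw pol K (E ∪ Eᶜ) := by rw [Set.union_compl_self]
    _ ≤ M.runLaw pol K E + M.runLaw pol K Eᶜ := measure_union_le _ _
    _ ≤ _ := by gcongr

end MDP

namespace Assumptions

variable {M : MDP S A H} {F G : Fin H → Set (S × A → ℝ)} {greedy : QTuple S A H → Policy S A H}

lemma sum_integral_resid_le (hM : Assumptions M F G greedy) {fs : ℕ → QTuple S A H}
    {x : ℕ → S × A} {k K d : ℕ} {β : ℝ} (hβ : 1 ≤ β) (hk : k ≤ K) (hK : 0 < K) (h : Fin H)
    (hfs : ∀ t < k, fs t ∈ prodClass F)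
    (hpop : ∀ t < k, ∑ i ∈ Finset.range t, ∫ y, M.resid (fs t) h y ^ 2
      ∂(M.occ (greedy (fs i)) h) ≤ 16 * β)
    (hemp : ∀ t < k, ∑ i ∈ Finset.range t, M.resid (fs t) h (x i) ^ 2 ≤ 16 * β)
    (hdev : ∑ t ∈ Finset.range k, ((∫ y, M.resid (fs t) h y ∂(M.occ (greedy (fs t)) h)) -
      M.resid (fs t) h (x t)) ≤ 3 / 2 * √(k * β))
    (hd : deDim (M.residuals F h) (diracFamily S A) (1 / √K) ≤ d ∨
      deDim (M.residuals F h) (M.greedyFamily F greedy h) (1 / √K) ≤ d) :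
    ∑ t ∈ Finset.range k, ∫ y, M.resid (fs t) h y ∂(M.occ (greedy (fs t)) h) ≤
      12 * √(max (d : ℝ) 1 * k * β) := by
  have hK' : (0 : ℝ) < K := by exact_mod_cast hK
  have hω : 0 < 1 / √(K : ℝ) := by positivity
  have hphi : ∀ t < k, M.resid (fs t) h ∈ M.residuals F h := fun t ht => ⟨fs t, hfs t ht, rfl⟩
  have hocc : ∀ t < k, IsProbabilityMeasure (M.occ (greedy (fs t)) h) := fun t ht =>
    MDP.isProbabilityMeasure_occ (hM.greedy.measurable _ (hfs t ht)) h
  have hβ0 : (0 : ℝ) ≤ 16 * β := by linarith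
  set R := √(max (d : ℝ) 1 * k * β) with hR
  have hm1 : (1 : ℝ) ≤ max (d : ℝ) 1 := le_max_right _ _
  have hmd : (d : ℝ) ≤ max (d : ℝ) 1 := le_max_left _ _
  have hk0 : (0 : ℝ) ≤ k := Nat.cast_nonneg k
  -- The error terms are at most `1`, `8`, `1` and `3 / 2` times `R`; their total `23 / 2` is below
  -- `12`.
  have r1 : k * (1 / √(K : ℝ)) ≤ R := by
    have h1 : k * (1 / √(K : ℝ)) ≤ √k := by
      rw [mul_one_div, div_le_iff₀ (by positivity)]
      calc (k : ℝ) = √k * √k := (Real.mul_self_sqrt hk0).symm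
        _ ≤ √k * √K := by gcongr
    refine h1.trans (Real.sqrt_le_sqrt ?_)
    calc (k : ℝ) = 1 * k * 1 := by ring
      _ ≤ max (d : ℝ) 1 * k * β := by gcongr
  have r2 : 2 * √(d * (16 * β) * k) ≤ 8 * R := by
    have : √(d * (16 * β) * k) = 4 * √(d * k * β) := by
      rw [show d * (16 * β) * k = 4 ^ 2 * (d * k * β) by ring, Real.sqrt_mul (by positivity),
        Real.sqrt_sq (by norm_num)]
    rw [this]
    have : √(d * k * β) ≤ R := Real.sqrt_le_sqrt (by gcongr)
    linarith
  have r3 : √((d : ℝ) * k) ≤ R := by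
    refine Real.sqrt_le_sqrt ?_
    calc (d : ℝ) * k = d * k * 1 := by ring
      _ ≤ max (d : ℝ) 1 * k * β := by gcongr
  have r4 : √(k * β) ≤ R := by
    refine Real.sqrt_le_sqrt ?_
    calc (k : ℝ) * β = 1 * k * β := by ring
      _ ≤ max (d : ℝ) 1 * k * β := by gcongr
  have hR0 : 0 ≤ R := Real.sqrt_nonneg _
  -- For point masses the dimension bounds the observed residuals, and `hdev` passes to their
  -- expectations. For the laws of greedy policies it bounds the expectations directly, and `hpop`
  -- enters through Jensen's inequality.
  rcases hd with hd | hd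
  · have hdirac : ∀ t < k, ∀ y, ∫ y', M.resid (fs t) h y' ∂(Measure.dirac y) =
        M.resid (fs t) h y := fun t ht y =>
      integral_dirac' _ _ (hM.measurable_resid (hfs t ht) h).stronglyMeasurable
    have key := sum_abs_integral_le hω hd (φ := fun t => M.resid (fs t) h)
      (μ := fun t => Measure.dirac (x t)) (k := k) hphi (fun t _ => ⟨x t, rfl⟩)
      (fun t ht => by
        rw [hdirac t ht]; exact hM.abs_resid_le_one (hfs t ht) h _) hβ0
      (fun t ht => by
        simp only [hdirac t ht]
        exact hemp t ht)
    have h1 : ∑ t ∈ Finset.range k, M.resid (fs t) h (x t) ≤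
        ∑ t ∈ Finset.range k, |∫ y', M.resid (fs t) h y' ∂(Measure.dirac (x t))| :=
      Finset.sum_le_sum fun t ht => by
        rw [hdirac t (Finset.mem_range.1 ht)]; exact le_abs_self _
    rw [Finset.sum_sub_distrib] at hdev
    linarith
  · have key := sum_abs_integral_le hω hd (φ := fun t => M.resid (fs t) h)
      (μ := fun t => M.occ (greedy (fs t)) h) (k := k) hphi
      (fun t ht => ⟨fs t, hfs t ht, rfl⟩)
      (fun t ht => by
        have := hocc t ht
        exact abs_integral_le_of_abs_le (hM.abs_resid_le_one (hfs t ht) h)) hβ0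
      (fun t ht => by
        refine (Finset.sum_le_sum fun i hi => ?_).trans (hpop t ht)
        have := hocc i ((Finset.mem_range.1 hi).trans ht)
        exact sq_integral_le_integral_sq (hM.measurable_resid (hfs t ht) h)
          (hM.abs_resid_le_one (hfs t ht) h))
    have h1 : ∑ t ∈ Finset.range k, ∫ y, M.resid (fs t) h y ∂(M.occ (greedy (fs t)) h) ≤
        ∑ t ∈ Finset.range k, |∫ y, M.resid (fs t) h y ∂(M.occ (greedy (fs t)) h)| :=
      Finset.sum_le_sum fun t _ => le_abs_self _
    linarith

/-- The deterministic part of the regret analysis. -/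
lemma regret_le [NeZero H] (hM : Assumptions M F G greedy) {K d : ℕ} (hK : 0 < K) {β : ℝ}
    (hβ : 1 ≤ β)
    {sel : (k : ℕ) → (Fin k → Traj S A H) → QTuple S A H} (hsel : IsGolf M F G K β greedy sel)
    (D : Fin K → Traj S A H)
    (hopt : ∀ t (ht : t < K), M.Qstar ∈ M.confSet F G β (MDP.pre D t ht.le))
    (hpop : ∀ t (ht : t < K) (h : Fin H), ∑ i : Fin t, ∫ y,
      M.resid (sel t (MDP.pre D t ht.le)) h y ^ 2
        ∂(M.occ (greedy (sel i (MDP.pre D i (i.2.trans ht).le))) h) ≤ 16 * β)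
    (hemp : ∀ t (ht : t < K) (h : Fin H), ∑ i : Fin t,
      M.resid (sel t (MDP.pre D t ht.le)) h (MDP.pre D t ht.le i h).1 ^ 2 ≤ 16 * β)
    (hdev : ∀ k (hk : k ≤ K) (h : Fin H), ∑ t : Fin k, ((∫ y,
      M.resid (sel t (MDP.pre D t (t.2.le.trans hk))) h y
        ∂(M.occ (greedy (sel t (MDP.pre D t (t.2.le.trans hk)))) h)) -
      M.resid (sel t (MDP.pre D t (t.2.le.trans hk))) h (MDP.pre D k hk t h).1) ≤
        3 / 2 * √(k * β))
    (hd : (∀ h, deDim (M.residuals F h) (diracFamily S A) (1 / √K) ≤ d) ∨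
      ∀ h, deDim (M.residuals F h) (M.greedyFamily F greedy h) (1 / √K) ≤ d)
    (k : ℕ) (hk : k ≤ K) :
    M.regret (fun t D' => greedy (sel t D')) D k hk ≤
      12 * H * √(max (d : ℝ) 1 * k * β) := by
  -- The sequences are extended beyond `K` by arbitrary values, which are never used.
  set fs : ℕ → QTuple S A H := fun t =>
    if ht : t < K then sel t (MDP.pre D t ht.le) else M.Qstar with hfsdef
  set x : ℕ → Traj S A H := fun t => if ht : t < K then D ⟨t, ht⟩ else D ⟨0, hK⟩ with hxdef
  have hfs : ∀ t (ht : t < K), fs t = sel t (MDP.pre D t ht.le) := fun t ht => dif_pos ht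
  have hx : ∀ t (ht : t < K), x t = D ⟨t, ht⟩ := fun t ht => dif_pos ht
  have hmem : ∀ t < k, fs t ∈ prodClass F := fun t ht => by
    rw [hfs t (by omega)]; exact hsel.mem t (by omega) _
  have hstep : ∀ t < k, M.Vstar 0 M.s₁ - M.V (greedy (fs t)) 0 M.s₁ ≤
      ∑ h, ∫ y, M.resid (fs t) h y ∂(M.occ (greedy (fs t)) h) := by
    intro t ht
    have htK : t < K := by omega
    rw [← MDP.sub_V_eq_sum_integral_resid hM.r_le_one (hM.measurable_of_mem (hmem t ht))
      (hM.mem_Icc_of_mem (hmem t ht)) (hM.greedy.measurable _ (hmem t ht))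
      (hM.greedy.isMax _ (hmem t ht))]
    -- Optimism: `V^⋆_1(s_1)` is at most the value claimed by `Q^⋆`, a candidate in the maximization
    -- defining `f^t`.
    have h1 := MDP.Vstar_le hM.r_le_one (hM.greedy.measurable _ hM.Qstar_mem)
      (hM.greedy.isMax _ hM.Qstar_mem) M.s₁
    have h2 := hsel.isMax t htK _ _ (hopt t htK)
    rw [← hfs t htK] at h2
    linarith
  have hreg : M.regret (fun t D' => greedy (sel t D')) D k hk =
      ∑ t ∈ Finset.range k, (M.Vstar 0 M.s₁ - M.V (greedy (fs t)) 0 M.s₁) := by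
    rw [MDP.regret, Finset.sum_range]
    refine Finset.sum_congr rfl fun t _ => ?_
    rw [hfs t (t.2.trans_le hk)]
    rfl
  rw [hreg]
  refine (Finset.sum_le_sum fun t ht => hstep t (Finset.mem_range.1 ht)).trans ?_
  rw [Finset.sum_comm]
  have hper : ∀ h : Fin H, ∑ t ∈ Finset.range k,
      ∫ y, M.resid (fs t) h y ∂(M.occ (greedy (fs t)) h) ≤
        12 * √(max (d : ℝ) 1 * k * β) := by
    intro h
    refine hM.sum_integral_resid_le (x := fun t => (x t h).1) hβ hk hK h hmem ?_ ?_ ?_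
      (hd.imp (fun hd => hd h) fun hd => hd h)
    · intro t ht
      have htK : t < K := by omega
      rw [Finset.sum_range, hfs t htK]
      refine le_of_eq_of_le (Finset.sum_congr rfl fun i _ => ?_) (hpop t htK h)
      rw [hfs i (i.2.trans htK)]
    · intro t ht
      have htK : t < K := by omega
      rw [Finset.sum_range, hfs t htK]
      refine le_of_eq_of_le (Finset.sum_congr rfl fun i _ => ?_) (hemp t htK h)
      rw [hx i (i.2.trans htK)]
      rfl
    · rw [Finset.sum_range]
      refine le_of_eq_of_le (Finset.sum_congr rfl fun t _ => ?_) (hdev k hk h)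
      rw [hfs t (t.2.trans_le hk), hx t (t.2.trans_le hk)]
      rfl
  refine (Finset.sum_le_sum fun h _ => hper h).trans (le_of_eq ?_)
  rw [Finset.sum_const, Finset.card_univ, Fintype.card_fin, nsmul_eq_mul]
  ring

end Assumptions

end Regret

/-! ### The good event -/

section GoodEvent

variable {S A : Type*} [MeasurableSpace S] [MeasurableSpace A] {H : ℕ}

namespace Assumptions

variable {M : MDP S A H} {F G : Fin H → Set (S × A → ℝ)} {greedy : QTuple S A H → Policy S A H}

/-- A supremum over an arbitrary action space need not be measurable; it is replaced by the value at
the greedy action. -/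
lemma measurable_maxVal_sel [NeZero H] (hM : Assumptions M F G greedy) {K : ℕ} {β : ℝ}
    {sel : (k : ℕ) → (Fin k → Traj S A H) → QTuple S A H} (hsel : IsGolf M F G K β greedy sel)
    {t : ℕ} (ht : t < K) (j : ℕ) :
    Measurable fun p : (Fin t → Traj S A H) × S => maxVal (entry (sel t p.1) j) p.2 := by
  by_cases hj : j < H
  · have : (fun p : (Fin t → Traj S A H) × S => maxVal (entry (sel t p.1) j) p.2) =
        fun p => sel t p.1 ⟨j, hj⟩ (p.2, greedy (sel t p.1) ⟨j, hj⟩ p.2) := by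
      funext p
      rw [entry_of_lt _ hj]
      exact maxVal_eq_of_le (hM.greedy.isMax _ (hsel.mem t ht p.1) ⟨j, hj⟩ p.2)
    rw [this]
    exact (hsel.measurable_sel t ht ⟨j, hj⟩).comp (measurable_fst.prodMk
      (measurable_snd.prodMk (hsel.measurable_policy t ht ⟨j, hj⟩)))
  · simp only [entry_of_not_lt _ hj, maxVal_zero]
    exact measurable_const

lemma measurable_resid_sel [NeZero H] (hM : Assumptions M F G greedy) {K : ℕ} {β : ℝ}
    {sel : (k : ℕ) → (Fin k → Traj S A H) → QTuple S A H} (hsel : IsGolf M F G K β greedy sel)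
    {t : ℕ} (ht : t < K) (h : Fin H) :
    Measurable fun p : (Fin t → Traj S A H) × (S × A) => M.resid (sel t p.1) h p.2 := by
  refine (hsel.measurable_sel t ht h).sub (((M.measurable_r h).comp measurable_snd).add ?_)
  exact measurable_integral_family
    (κ := fun p : (Fin t → Traj S A H) × (S × A) => M.P h p.2)
    ((M.P h).measurable.comp measurable_snd) (fun _ => inferInstance)
    (F := fun p s' => maxVal (entry (sel t p.1) (h + 1)) s')
    ((hM.measurable_maxVal_sel hsel ht (h + 1)).comp
      ((measurable_fst.comp measurable_fst).prodMk measurable_snd))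

/-- The exponents of the supermartingales that are controlled on the good event: the residuals of
a net of `F` on the data and in expectation, the errors of a net of `G`, and the deviation of the
residuals of the selected functions from their expectations. -/
def exponent (M : MDP S A H) (greedy : QTuple S A H → Policy S A H)
    (sel : (k : ℕ) → (Fin k → Traj S A H) → QTuple S A H) {N : ℕ}
    (zF zG : Fin N → QTuple S A H) (L : ℝ) {K : ℕ} :
    Fin (K + 1) × Fin H × (Fin N ⊕ Fin N ⊕ Fin N ⊕ Unit) →
      (t : ℕ) → (Fin t → Traj S A H) → Traj S A H → ℝ
  | (_, h, .inl j), _, _, τ =>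
      M.gap h (zF j h) (maxVal (entry (zF j) (h + 1))) (τ h).1 ^ 2 / 2 -
        M.excess h (zF j h) (maxVal (entry (zF j) (h + 1))) (τ h)
  | (_, h, .inr (.inl j)), t, D, τ =>
      (∫ x, M.gap h (zF j h) (maxVal (entry (zF j) (h + 1))) x ^ 2
        ∂(M.occ (greedy (sel t D)) h)) / 4 -
        M.excess h (zF j h) (maxVal (entry (zF j) (h + 1))) (τ h)
  | (_, h, .inr (.inr (.inl j))), _, _, τ =>
      M.gap h (zG j h) (maxVal (entry M.Qstar (h + 1))) (τ h).1 ^ 2 / 2 -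
        M.excess h (zG j h) (maxVal (entry M.Qstar (h + 1))) (τ h)
  -- The tilt `√(L / n)` is tuned to the prefix length `n`, which must therefore be part of the
  -- index. For `n = 0` it is `0` by the convention for division.
  | (n, h, .inr (.inr (.inr _))), t, D, τ =>
      √(L / n) * ((∫ x, M.resid (sel t D) h x ∂(M.occ (greedy (sel t D)) h)) -
        M.resid (sel t D) h (τ h).1) - √(L / n) ^ 2 / 2

lemma measurable_exponent [NeZero H] (hM : Assumptions M F G greedy) {K : ℕ} {β : ℝ}
    {sel : (k : ℕ) → (Fin k → Traj S A H) → QTuple S A H} (hsel : IsGolf M F G K β greedy sel)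
    {N : ℕ} {zF zG : Fin N → QTuple S A H} (hzF : ∀ j, zF j ∈ prodClass F)
    (hzG : ∀ j, zG j ∈ prodClass G) (L : ℝ)
    (i : Fin (K + 1) × Fin H × (Fin N ⊕ Fin N ⊕ Fin N ⊕ Unit)) {t : ℕ} (ht : t < K) :
    Measurable fun p : (Fin t → Traj S A H) × Traj S A H =>
      exponent M greedy sel zF zG L i t p.1 p.2 := by
  have hlaw : Measurable fun D : Fin t → Traj S A H =>
      trajLaw H M.P (greedy (sel t D)) M.s₁ :=
    measurable_trajLaw_param (hsel.measurable_policy t ht) _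
  have hprob : ∀ D : Fin t → Traj S A H,
      IsProbabilityMeasure (trajLaw H M.P (greedy (sel t D)) M.s₁) := fun D =>
    isProbabilityMeasure_trajLaw (hM.greedy.measurable _ (hsel.mem t ht D)) _
  obtain ⟨n, h, j | j | j | j⟩ := i
  all_goals
    have hx : Measurable fun p : (Fin t → Traj S A H) × Traj S A H => p.2 h :=
      (measurable_pi_apply h).comp measurable_snd
    have hx1 : Measurable fun p : (Fin t → Traj S A H) × Traj S A H => (p.2 h).1 :=
      measurable_fst.comp hx
    simp only [exponent]
  · have hu := hM.measurable_of_mem (hzF j) h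
    have hv := hM.measurable_maxVal (hzF j) (h + 1)
    exact ((((MDP.measurable_gap hu hv).comp hx1).pow_const 2).div_const 2).sub
      ((MDP.measurable_excess hu hv).comp hx)
  · have hu := hM.measurable_of_mem (hzF j) h
    have hv := hM.measurable_maxVal (hzF j) (h + 1)
    have hg := (MDP.measurable_gap (M := M) (h := h) hu hv).pow_const 2
    simp only [MDP.integral_occ h hg]
    refine Measurable.sub (Measurable.div_const ?_ 4) ((MDP.measurable_excess hu hv).comp hx)
    exact (measurable_integral_family hlaw hprob
      (F := fun _ τ => M.gap h (zF j h) (maxVal (entry (zF j) (h + 1))) (τ h).1 ^ 2)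
      (hg.comp hx1)).comp measurable_fst
  · have hu := (hM.memG h _ (hzG j h trivial)).1
    have hv := hM.measurable_maxVal hM.Qstar_mem (h + 1)
    exact ((((MDP.measurable_gap hu hv).comp hx1).pow_const 2).div_const 2).sub
      ((MDP.measurable_excess hu hv).comp hx)
  · have hres := hM.measurable_resid_sel hsel ht h
    have hocc : ∀ D : Fin t → Traj S A H, ∫ x, M.resid (sel t D) h x
        ∂(M.occ (greedy (sel t D)) h) = ∫ τ, M.resid (sel t D) h (τ h).1
        ∂(trajLaw H M.P (greedy (sel t D)) M.s₁) := fun D =>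
      MDP.integral_occ h (hM.measurable_resid (hsel.mem t ht D) h)
    simp only [hocc]
    refine ((Measurable.sub ?_ (hres.comp (measurable_fst.prodMk hx1))).const_mul _).sub_const _
    exact (measurable_integral_family hlaw hprob
      (F := fun D τ => M.resid (sel t D) h (τ h).1)
      (hres.comp (measurable_fst.prodMk hx1))).comp measurable_fst

lemma lintegral_exp_exponent_le [NeZero H] (hM : Assumptions M F G greedy) {K : ℕ} {β : ℝ}
    {sel : (k : ℕ) → (Fin k → Traj S A H) → QTuple S A H} (hsel : IsGolf M F G K β greedy sel)
    {N : ℕ} {zF zG : Fin N → QTuple S A H} (hzF : ∀ j, zF j ∈ prodClass F)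
    (hzG : ∀ j, zG j ∈ prodClass G) (L : ℝ)
    (i : Fin (K + 1) × Fin H × (Fin N ⊕ Fin N ⊕ Fin N ⊕ Unit)) {t : ℕ} (ht : t < K)
    (D : Fin t → Traj S A H) :
    ∫⁻ τ, ENNReal.ofReal (Real.exp (exponent M greedy sel zF zG L i t D τ))
      ∂(trajLaw H M.P (greedy (sel t D)) M.s₁) ≤ 1 := by
  have hπ := hM.greedy.measurable _ (hsel.mem t ht D)
  obtain ⟨n, h, j | j | j | j⟩ := i
  · exact MDP.lintegral_exp_empirical_le hπ h (hM.measurable_of_mem (hzF j) h)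
      (hM.measurable_maxVal (hzF j) _) (hM.maxVal_mem_Icc (hzF j) _)
  · exact MDP.lintegral_exp_population_le hπ h (hM.measurable_of_mem (hzF j) h)
      (hM.measurable_maxVal (hzF j) _) (hM.maxVal_mem_Icc (hzF j) _)
      (hM.abs_gap_le_one (hzF j) h (hM.mem_Icc_of_mem (hzF j) h))
  · exact MDP.lintegral_exp_empirical_le hπ h (hM.memG h _ (hzG j h trivial)).1
      (hM.measurable_maxVal hM.Qstar_mem _) (hM.maxVal_mem_Icc hM.Qstar_mem _)
  · exact MDP.lintegral_exp_deviation_le hπ h (hM.measurable_resid (hsel.mem t ht D) h)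
      (hM.abs_resid_le_one (hsel.mem t ht D) h) _

/-- The regret bound on the good event. -/
lemma regret_le_of_good [NeZero H] (hM : Assumptions M F G greedy) {K d : ℕ} (hK : 0 < K)
    {β L : ℝ} (hL : 8 / 3 ≤ L) (hβ : β = 4 * L)
    {sel : (k : ℕ) → (Fin k → Traj S A H) → QTuple S A H} (hsel : IsGolf M F G K β greedy sel)
    {N : ℕ} {zF zG : Fin N → QTuple S A H} (hzF : ∀ j, zF j ∈ prodClass F)
    (hzG : ∀ j, zG j ∈ prodClass G)
    (hnetF : ∀ f ∈ prodClass F, ∃ j, ∀ h x, |f h x - zF j h x| ≤ 2 * (1 / K))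
    (hnetG : ∀ g ∈ prodClass G, ∃ j, ∀ h x, |g h x - zG j h x| ≤ 2 * (1 / K))
    (D : Fin K → Traj S A H)
    (hgood : ∀ i : Fin (K + 1) × Fin H × (Fin N ⊕ Fin N ⊕ Fin N ⊕ Unit),
      MDP.cumSum (exponent M greedy sel zF zG L i)
        (MDP.pre D i.1 (Nat.lt_succ_iff.1 i.1.2)) < L)
    (hd : (∀ h, deDim (M.residuals F h) (diracFamily S A) (1 / √K) ≤ d) ∨
      ∀ h, deDim (M.residuals F h) (M.greedyFamily F greedy h) (1 / √K) ≤ d)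
    (k : ℕ) (hk : k ≤ K) :
    M.regret (fun t D' => greedy (sel t D')) D k hk ≤
      12 * H * √(max (d : ℝ) 1 * k * β) := by
  -- Membership needs `L + 8 ≤ β = 4 * L`, which is the condition `8 / 3 ≤ L`.
  have hopt : ∀ t (ht : t < K), M.Qstar ∈ M.confSet F G β (MDP.pre D t ht.le) := fun t ht =>
    hM.Qstar_mem_confSet ht.le hK _ hzG hnetG
      (fun h j => hgood (⟨t, by omega⟩, h, .inr (.inr (.inl j)))) (by linarith)
  have hconf : ∀ t (ht : t < K), sel t (MDP.pre D t ht.le) ∈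
      M.confSet F G β (MDP.pre D t ht.le) := fun t ht =>
    hsel.mem_confSet t ht _ ⟨_, hopt t ht⟩
  refine hM.regret_le hK (by linarith) hsel D hopt ?_ ?_ ?_ hd k hk
  · intro t ht h
    obtain ⟨j, hj⟩ := hnetF _ (hconf t ht).1
    refine (hM.sum_integral_sq_resid_le ht.le hK (hconf t ht) (hzF j) hj (L := L) h
      (fun i => MDP.isProbabilityMeasure_occ
        (hM.greedy.measurable _ (hsel.mem i (i.2.trans ht) _)) h)
      (hgood (⟨t, by omega⟩, h, .inr (.inl j)))).trans ?_
    -- The bound is `4 * (β + 24 + L) + 8 = 5 * β + 104`, below `16 * β` since `β ≥ 32 / 3`.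
    linarith
  · intro t ht h
    obtain ⟨j, hj⟩ := hnetF _ (hconf t ht).1
    refine (hM.sum_sq_resid_le ht.le hK (hconf t ht) (hzF j) hj (L := L) h
      (hgood (⟨t, by omega⟩, h, .inl j))).trans ?_
    linarith
  · intro n hn h
    rcases Nat.eq_zero_or_pos n with rfl | hn0
    · simp
    have hn0' : (0 : ℝ) < n := by exact_mod_cast hn0
    have hL0 : 0 < L := by linarith
    have hg := hgood (⟨n, by omega⟩, h, .inr (.inr (.inr ())))
    simp only [MDP.cumSum, exponent] at hg
    rw [Finset.sum_sub_distrib, ← Finset.mul_sum, Finset.sum_const, Finset.card_univ,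
      Fintype.card_fin, nsmul_eq_mul, Real.sq_sqrt (by positivity)] at hg
    have e1 : (n : ℝ) * (L / n / 2) = L / 2 := by field_simp
    rw [e1] at hg
    -- With tilt `l = √(L / n)` the event reads `l * sum - L / 2 < L`. Dividing `3 / 2 * L` by `l`
    -- gives `3 / 2 * √(n * L)`.
    have hl : 0 < √(L / n) := Real.sqrt_pos.2 (by positivity)
    have e2 : √(n * L) * √(L / n) = L := by
      rw [← Real.sqrt_mul (by positivity), show n * L * (L / n) = L ^ 2 by field_simp,
        Real.sqrt_sq hL0.le]
    have hle : √(n * L) ≤ √(n * β) := Real.sqrt_le_sqrt (by gcongr; linarith)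
    refine le_trans ?_ (mul_le_mul_of_nonneg_left hle (by norm_num))
    refine le_of_mul_le_mul_left (le_trans (b := 3 / 2 * L) ?_ (le_of_eq ?_)) hl
    · refine le_trans (le_of_lt (lt_of_eq_of_lt ?_ (lt_add_of_sub_right_lt hg)))
        (le_of_eq (by ring))
      rfl
    · calc 3 / 2 * L = 3 / 2 * (√(n * L) * √(L / n)) := by rw [e2]
        _ = _ := by ring

end Assumptions

end GoodEvent

end Golf

end

/-! ### Choice of constants and conclusion -/

theorem theorem1 :
    ∃ c C : ℝ, 0 < c ∧ 0 < C ∧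
      ∀ (S : Type*) (A : Type*) [MeasurableSpace S] [MeasurableSpace A]
        (H : ℕ) [NeZero H] (M : Golf.MDP S A H)
        (F G : Fin H → Set (S × A → ℝ))
        (_ : ∀ h, ∀ f ∈ F h, Measurable f ∧ ∀ x, f x ∈ Set.Icc (0 : ℝ) 1)
        (_ : ∀ h, ∀ g ∈ G h, Measurable g ∧ ∀ x, g x ∈ Set.Icc (0 : ℝ) 1)
        (greedy : Golf.QTuple S A H → Golf.Policy S A H) (_ : Golf.IsGreedy F greedy)
        (_ : M.Realizable F) (_ : M.Complete F G)
        (δ : ℝ) (_ : 0 < δ) (_ : δ ≤ 1) (K : ℕ) (_ : 2 ≤ K)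
        (N : ℕ)
        (_ : Golf.coverNum (Golf.prodClass F ∪ Golf.prodClass G) (1 / (K : NNReal)) = N)
        (d : ℕ)
        (_ : min (M.beDim F (fun _ => Golf.diracFamily S A) (1 / Real.sqrt K))
          (M.beDim F (M.greedyFamily F greedy) (1 / Real.sqrt K)) = d)
        (β : ℝ) (_ : β = c * Real.log (N * (K * H) / δ))
        (sel : (k : ℕ) → (Fin k → Golf.Traj S A H) → Golf.QTuple S A H)
        (_ : Golf.IsGolf M F G K β greedy sel),
        ENNReal.ofReal (1 - δ) ≤
          M.runLaw (fun t D => greedy (sel t D)) K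
            {D | ∀ (k : ℕ) (hk : k ≤ K),
              M.regret (fun t D' => greedy (sel t D')) D k hk ≤
                C * H * Real.sqrt (max d 1 * k * β)} := by
  refine ⟨16, 12, by norm_num, by norm_num, ?_⟩
  intro S A _ _ H _ M F G hF hG greedy hgreedy hreal hcomp δ hδ0 hδ1 K hK N hN d hd β hβ sel hsel
  have hM : Golf.Assumptions M F G greedy := ⟨hF, hG, hgreedy, hreal, hcomp⟩
  obtain ⟨zF, hzF, hnetF⟩ := Golf.exists_net_of_subset Set.subset_union_left
    ⟨_, hM.Qstar_mem⟩ hN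
  obtain ⟨zG, hzG, hnetG⟩ := Golf.exists_net_of_subset Set.subset_union_right
    ⟨_, hM.Qstar_mem_G⟩ hN
  have hN1 : 1 ≤ N := Golf.coverNum_pos ⟨_, Or.inl hM.Qstar_mem⟩ hN
  have hN1' : (1 : ℝ) ≤ N := by exact_mod_cast hN1
  have hK2 : (2 : ℝ) ≤ K := by exact_mod_cast hK
  have hH1 : (1 : ℝ) ≤ H := by exact_mod_cast NeZero.one_le (n := H)
  set y : ℝ := N * (K * H) / δ with hy
  have hyδ : y * δ = N * (K * H) := by rw [hy]; field_simp
  have hnum : (2 : ℝ) ≤ N * (K * H) := by nlinarith [mul_le_mul hK2 hH1 (by norm_num) (by linarith)]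
  have hy2 : 2 ≤ y := by
    rw [hy, le_div_iff₀ hδ0]
    nlinarith
  have hlog : Real.log 2 ≤ Real.log y := Real.log_le_log (by norm_num) hy2
  -- The threshold makes `exp (-L) = y⁻⁴`. One factor `y` pays for the number of events through `N *
  -- (K * H) = y * δ`, and the other three absorb the constant `8` because `y ≥ 2`. With `β = 4 * L`
  -- this gives `c = 16`.
  set L := 4 * Real.log y with hL
  have hL83 : 8 / 3 ≤ L := by
    have := Real.log_two_gt_d9
    rw [hL]; linarith
  have hβL : β = 4 * L := by rw [hβ, hL]; ring
  have hpol : Golf.MDP.MeasurablePol (fun t D => greedy (sel t D)) K := hsel.measurable_policy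
  have key := Golf.MDP.runLaw_forall_cumSum_lt (M := M) hpol
    (ψ := Golf.Assumptions.exponent M greedy sel zF zG L (K := K))
    (fun i t ht => hM.measurable_exponent hsel hzF hzG L i ht)
    (fun i t ht D => hM.lintegral_exp_exponent_le hsel hzF hzG L i ht D)
    (n := fun i => i.1) (fun i => Nat.lt_succ_iff.1 i.1.2) L
  refine le_trans (ENNReal.ofReal_le_ofReal ?_) (key.trans (MeasureTheory.measure_mono ?_))
  · have hexp : Real.exp (-L) * y ^ 4 = 1 := by
      have : y ^ 4 = Real.exp L := by
        rw [hL, show (4 : ℝ) * Real.log y = (4 : ℕ) * Real.log y by norm_num, Real.exp_nat_mul,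
          Real.exp_log (by linarith)]
      rw [this, ← Real.exp_add]; simp
    have hcard : (Fintype.card (Fin (K + 1) × Fin H × (Fin N ⊕ Fin N ⊕ Fin N ⊕ Unit)) : ℝ) ≤
        8 * (N * (K * H)) := by
      simp only [Fintype.card_prod, Fintype.card_fin, Fintype.card_sum, Fintype.card_unit]
      push_cast
      have h1 : (K : ℝ) + 1 ≤ 2 * K := by linarith
      have h2 : (N : ℝ) + (N + (N + 1)) ≤ 4 * N := by linarith
      calc ((K : ℝ) + 1) * (H * (N + (N + (N + 1)))) ≤ (2 * K) * (H * (4 * N)) := by gcongr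
        _ = _ := by ring
    have hy3 : (8 : ℝ) ≤ y ^ 3 := by
      calc (8 : ℝ) = 2 ^ 3 := by norm_num
        _ ≤ y ^ 3 := by gcongr
    have : (Fintype.card (Fin (K + 1) × Fin H × (Fin N ⊕ Fin N ⊕ Fin N ⊕ Unit)) : ℝ) *
        Real.exp (-L) ≤ δ := by
      calc _ ≤ 8 * (N * (K * H)) * Real.exp (-L) := by gcongr
        _ = 8 * (y * δ) * Real.exp (-L) := by rw [hyδ]
        _ ≤ y ^ 3 * (y * δ) * Real.exp (-L) := by gcongr
        _ = δ * (Real.exp (-L) * y ^ 4) := by ring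
        _ = δ := by rw [hexp, mul_one]
    linarith
  · intro D hD k hk
    have hd' : (∀ h, Golf.deDim (M.residuals F h) (Golf.diracFamily S A) (1 / √K) ≤ d) ∨
        ∀ h, Golf.deDim (M.residuals F h) (M.greedyFamily F greedy h) (1 / √K) ≤ d := by
      -- The minimum is attained by one of the two families, and its dimension bounds that of every
      -- step.
      rcases min_choice (M.beDim F (fun _ => Golf.diracFamily S A) (1 / Real.sqrt K))
        (M.beDim F (M.greedyFamily F greedy) (1 / Real.sqrt K)) with h | h
      · left
        intro i
        rw [← hd, h]
        exact le_iSup (fun i => Golf.deDim (M.residuals F i) (Golf.diracFamily S A) (1 / √K)) i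
      · right
        intro i
        rw [← hd, h]
        exact le_iSup (fun i => Golf.deDim (M.residuals F i) (M.greedyFamily F greedy i)
          (1 / √K)) i
    have hfinal := hM.regret_le_of_good (by omega) hL83 hβL hsel hzF hzG
      (fun f hf => by simpa using hnetF f hf) (fun g hg => by simpa using hnetG g hg) D hD hd' k hk
    simpa using hfinal
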